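/- Let $\rho\in\mathbb R$ and $\mu\neq 0$. Let $\mathbb M^3(\rho)$ be the simply connected complete Riemannian $3$-manifold of constant sectional curvature $\rho$ (Euclidean space, a round sphere, or a hyperbolic space) and let $\mathbb M^2(\rho)\subset\mathbb M^3(\rho)$ be the corresponding totally geodesic surface. Let $\gamma:I\to\mathbb M^2(\rho)$ be a smooth curve parametrized by arc length $s$ on an open interval $I$, with unit tangent $T$, smooth unit normal $N$ in $\mathbb M^2(\rho)$, signed curvature $\kappa$ given by $\nabla_TT=\kappa N$, and binormal $B$, the smooth unit vector field along $\gamma$ that is tangent to $\mathbb M^3(\rho)$ and orthogonal to $\mathbb M^2(\rho)$. Suppose that $\gamma$ is a critical curve of $\mathbf\Theta_\mu(\gamma)=\int_\gamma e^{\mu\kappa}\,ds$, in the sense that it satisfies the Euler--Lagrange equation $$\frac{d^2}{ds^2}\left(e^{\mu\kappa}\right)+\left(\kappa^2-\frac{\kappa}{\mu}+\rho\right)e^{\mu\kappa}=0\quad\text{on } I,$$ and that $\kappa$ is not constant. Then the vector field $\mathcal I=\mu e^{\mu\kappa}B$ along $\gamma$ extends to a unique Killing vector field on $\mathbb M^3(\rho)$.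 This field has a complete flow $\{\phi_t\}_{t\in\mathbb R}$, and the map $I\times\mathbb R\to\mathbb M^3(\rho)$, $(s,t)\mapsto\phi_t(\gamma(s))$, is a smooth immersed surface (the binormal evolution surface of $\gamma$) with the following properties. (i) It is a rotational surface with profile curve $\gamma$: $\{\phi_t\}$ is a nontrivial one-parameter group of rotations of $\mathbb M^3(\rho)$, the surface is invariant under it, and $\gamma$ is orthogonal to its orbits. Here, for $\rho\ge 0$, the rotations fix a geodesic pointwise; for $\rho<0$, they are spherical, parabolic or hyperbolic rotations, that is, in the hyperboloid model they are restrictions of linear isometries of Lorentz space $\mathbb R^{3,1}$ that fix a $2$-dimensional linear subspace pointwise. (ii) It has constant skew curvature $1/|\mu|$, that is, $2\sqrt{H^2-K+\rho}=|\kappa_1-\kappa_2|=1/|\mu|$ at every point, where $\kappa_1,\kappa_2$ are the principal curvatures, $H=(\kappa_1+\kappa_2)/2$ and $K=\kappa_1\kappa_2+\rho$. In particular, the value is $1/\mu$ when $\mu>0$. -/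

import Mathlib

open scoped ContDiff

noncomputable section

namespace SkewCurv

/-- The ambient vector space `ℝ⁴` of the hyperquadric models. -/
abbrev E4 : Type := Fin 4 → ℝ

/-- The ambient bilinear form: Euclidean for `ρ ≥ 0`, Lorentzian (last coordinate timelike)
for `ρ < 0`. -/
def form (ρ : ℝ) (u v : E4) : ℝ :=
  u 0 * v 0 + u 1 * v 1 + u 2 * v 2 + (if ρ < 0 then -1 else 1) * (u 3 * v 3)

/-- The 3-space form `M³(ρ)`: the hyperplane `ℝ³ × {0}` if `ρ = 0`, the round sphere
`⟨x,x⟩ = 1/ρ` if `ρ > 0`, the upper sheet of the hyperboloid `⟨x,x⟩ = 1/ρ` if `ρ < 0`,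
with the metric induced by `form ρ`. -/
def M3 (ρ : ℝ) : Set E4 :=
  {x | if ρ = 0 then x 3 = 0 else form ρ x x = 1 / ρ ∧ (ρ < 0 → 0 < x 3)}

/-- The tangent space of `M³(ρ)` at `x`. -/
def tangent (ρ : ℝ) (x : E4) : Set E4 :=
  {v | if ρ = 0 then v 3 = 0 else form ρ x v = 0}

/-- The 2-space form `M²(ρ)`, as a totally geodesic surface of `M³(ρ)`. -/
def M2 (ρ : ℝ) : Set E4 := {x | x ∈ M3 ρ ∧ x 2 = 0}

/-- The tangent space of `M²(ρ)` at `x`. -/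
def tangent2 (ρ : ℝ) (x : E4) : Set E4 := {v | v ∈ tangent ρ x ∧ v 2 = 0}

/-- Orthogonal projection onto the tangent space of `M³(ρ)` at `x` (applied to derivatives of
tangent fields). The Levi-Civita derivative of a tangent field along a map into `M³(ρ)` is the
projection of its derivative in `ℝ⁴`. -/
def proj (ρ : ℝ) (x w : E4) : E4 := w - (ρ * form ρ w x) • x

/-! ### Curves -/

/-- `γ` is a smooth curve in `M²(ρ)` parametrized by arc length on `I`, with (planar) Frenet frame
`T = γ'`, `N`, `B` and signed curvature `κ`: `N` is a smooth unit normal of `γ` in `M²(ρ)`,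
`∇_T T = κ N`, and the binormal `B` is a smooth unit vector field along `γ`, tangent to `M³(ρ)` and
orthogonal to `T` and `N`. Both orientations of `M²(ρ)` and of `M³(ρ)` are allowed. -/
structure IsPlanarFrenetCurve (ρ : ℝ) (I : Set ℝ) (γ N B : ℝ → E4) (κ : ℝ → ℝ) : Prop where
  smooth_curve : ContDiffOn ℝ ∞ γ I
  smooth_normal : ContDiffOn ℝ ∞ N I
  smooth_binormal : ContDiffOn ℝ ∞ B I
  mem : ∀ s ∈ I, γ s ∈ M2 ρ
  arc_length : ∀ s ∈ I, form ρ (deriv γ s) (deriv γ s) = 1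
  normal_tangent : ∀ s ∈ I, N s ∈ tangent2 ρ (γ s)
  normal_unit : ∀ s ∈ I, form ρ (N s) (N s) = 1
  normal_orth : ∀ s ∈ I, form ρ (deriv γ s) (N s) = 0
  curvature : ∀ s ∈ I, proj ρ (γ s) (deriv (deriv γ) s) = κ s • N s
  binormal_tangent : ∀ s ∈ I, B s ∈ tangent ρ (γ s)
  binormal_unit : ∀ s ∈ I, form ρ (B s) (B s) = 1
  binormal_orth_tangent : ∀ s ∈ I, form ρ (B s) (deriv γ s) = 0
  binormal_orth_normal : ∀ s ∈ I, form ρ (B s) (N s) = 0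

/-- A curve with curvature `κ` as a function of arc length is a critical curve of
`Θ_μ(γ) = ∫_γ exp (μ κ)` if it satisfies the Euler-Lagrange equation of `Θ_μ`
(no boundary conditions). -/
def IsCriticalCurve (ρ μ : ℝ) (I : Set ℝ) (κ : ℝ → ℝ) : Prop :=
  ∀ s ∈ I, deriv (deriv fun r => Real.exp (μ * κ r)) s
    + (κ s ^ 2 - κ s / μ + ρ) * Real.exp (μ * κ s) = 0

/-! ### Killing fields and flows -/

/-- `X` is (a smooth extension to `ℝ⁴` of) a smooth tangent vector field of `M³(ρ)` that is
Killing: `⟨∇_v X, w⟩ + ⟨v, ∇_w X⟩ = 0` for all tangent `v`, `w`. As `M³(ρ)` is a closed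
submanifold of `ℝ⁴`, every smooth vector field on it has such an extension. -/
structure IsKillingField (ρ : ℝ) (X : E4 → E4) : Prop where
  smooth : ContDiff ℝ ∞ X
  tangent : ∀ x ∈ M3 ρ, X x ∈ tangent ρ x
  killing : ∀ x ∈ M3 ρ, ∀ v ∈ SkewCurv.tangent ρ x, ∀ w ∈ SkewCurv.tangent ρ x,
    form ρ (proj ρ x (fderiv ℝ X x v)) w + form ρ v (proj ρ x (fderiv ℝ X x w)) = 0

/-- `X` is a Killing field of `M³(ρ)` that extends the field `μ exp (μ κ) B` along `γ`. -/
def IsKillingExtension (ρ μ : ℝ) (I : Set ℝ) (γ B : ℝ → E4) (κ : ℝ → ℝ) (X : E4 → E4) : Prop :=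
  IsKillingField ρ X ∧ ∀ s ∈ I, X (γ s) = (μ * Real.exp (μ * κ s)) • B s

/-- `φ` is the (complete) flow on `M³(ρ)` of the vector field `X`; its values outside `M³(ρ)` are
irrelevant. -/
structure IsFlow (ρ : ℝ) (X : E4 → E4) (φ : ℝ → E4 → E4) : Prop where
  zero : ∀ x ∈ M3 ρ, φ 0 x = x
  mapsTo : ∀ t, ∀ x ∈ M3 ρ, φ t x ∈ M3 ρ
  hasDerivAt : ∀ t, ∀ x ∈ M3 ρ, HasDerivAt (fun r => φ r x) (X (φ t x)) t

/-! ### Rotations and surfaces -/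

/-- `φ` is a (nontrivial) one-parameter group of rotations of `M³(ρ)`. For `ρ = 0` these are
isometries fixing a straight line pointwise. For `ρ ≠ 0` they are restrictions of linear isometries
of `(ℝ⁴, form ρ)` fixing a linear 2-plane `P` pointwise. If `ρ > 0`, the axis is the great circle
`P ∩ M³(ρ)`; if `ρ < 0`, the rotations are spherical (with axis the geodesic `P ∩ M³(ρ)`),
parabolic or hyperbolic when `P` is Lorentzian, degenerate or Riemannian, respectively. -/
structure IsRotationGroup (ρ : ℝ) (φ : ℝ → E4 → E4) : Prop where
  mapsTo : ∀ t, ∀ x ∈ M3 ρ, φ t x ∈ M3 ρ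
  zero : ∀ x ∈ M3 ρ, φ 0 x = x
  add : ∀ s t, ∀ x ∈ M3 ρ, φ (s + t) x = φ s (φ t x)
  continuous : ∀ x ∈ M3 ρ, Continuous fun t => φ t x
  nontrivial : ∃ t, ∃ x ∈ M3 ρ, φ t x ≠ x
  rotation_flat : ρ = 0 →
    (∀ t, ∀ x ∈ M3 ρ, ∀ y ∈ M3 ρ,
      form ρ (φ t x - φ t y) (φ t x - φ t y) = form ρ (x - y) (x - y)) ∧
    ∃ p ∈ M3 ρ, ∃ v ∈ tangent ρ p, v ≠ 0 ∧ ∀ t r : ℝ, φ t (p + r • v) = p + r • v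
  rotation_curved : ρ ≠ 0 →
    ∃ P : Submodule ℝ E4, Module.finrank ℝ P = 2 ∧
      ∀ t, ∃ A : E4 →ₗ[ℝ] E4, (∀ u v, form ρ (A u) (A v) = form ρ u v) ∧
        (∀ x ∈ P, A x = x) ∧ ∀ x ∈ M3 ρ, φ t x = A x

/-- First partial derivative of a parametrized surface, in the first variable. -/
def partialS (F : ℝ → ℝ → E4) : ℝ → ℝ → E4 := fun s t => deriv (fun r => F r t) s

/-- First partial derivative of a parametrized surface, in the second variable. -/
def partialT (F : ℝ → ℝ → E4) : ℝ → ℝ → E4 := fun s t => deriv (fun r => F s r) t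

/-- `F` is a smooth immersion of `I × ℝ` into `M³(ρ)`. -/
structure IsImmersedSurface (ρ : ℝ) (I : Set ℝ) (F : ℝ → ℝ → E4) : Prop where
  mem : ∀ s ∈ I, ∀ t, F s t ∈ M3 ρ
  smooth : ContDiffOn ℝ ∞ (fun p : ℝ × ℝ => F p.1 p.2) (I ×ˢ Set.univ)
  immersion : ∀ s ∈ I, ∀ t, LinearIndependent ℝ ![partialS F s t, partialT F s t]

/-- The immersed surface `F` on `I × ℝ` is a rotational surface of `M³(ρ)`: it is invariant under
the one-parameter group of rotations `φ`. -/
structure IsRotationalSurface (ρ : ℝ) (I : Set ℝ) (F : ℝ → ℝ → E4) (φ : ℝ → E4 → E4) : Prop where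
  immersed : IsImmersedSurface ρ I F
  rotation : IsRotationGroup ρ φ
  invariant : ∀ t, φ t '' {x | ∃ s ∈ I, ∃ r, x = F s r} = {x | ∃ s ∈ I, ∃ r, x = F s r}

/-- `γ` is a profile curve with respect to the group `φ`: it is orthogonal to the orbits. -/
def IsProfileCurve (ρ : ℝ) (I : Set ℝ) (γ : ℝ → E4) (φ : ℝ → E4 → E4) : Prop :=
  ∀ s ∈ I, form ρ (deriv γ s) (deriv (fun t => φ t (γ s)) 0) = 0

/-- `η` is a unit normal vector of the surface `F` in `M³(ρ)` at the parameter `(s, t)`. -/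
def IsUnitNormal (ρ : ℝ) (F : ℝ → ℝ → E4) (s t : ℝ) (η : E4) : Prop :=
  η ∈ tangent ρ (F s t) ∧ form ρ η η = 1 ∧
    form ρ η (partialS F s t) = 0 ∧ form ρ η (partialT F s t) = 0

/-- First fundamental form. -/
def firstForm (ρ : ℝ) (F : ℝ → ℝ → E4) (s t : ℝ) : Matrix (Fin 2) (Fin 2) ℝ :=
  let Fs := partialS F s t
  let Ft := partialT F s t
  !![form ρ Fs Fs, form ρ Fs Ft; form ρ Ft Fs, form ρ Ft Ft]

/-- Second fundamental form with respect to the unit normal `η`: `⟨∇_{∂ᵢ} ∂ⱼF, η⟩`. -/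
def secondForm (ρ : ℝ) (F : ℝ → ℝ → E4) (s t : ℝ) (η : E4) : Matrix (Fin 2) (Fin 2) ℝ :=
  let h := fun w => form ρ (proj ρ (F s t) w) η
  !![h (partialS (partialS F) s t), h (partialS (partialT F) s t);
     h (partialT (partialS F) s t), h (partialT (partialT F) s t)]

/-- Matrix of the shape operator `A_η` in the basis `∂ₛF`, `∂ₜF`; its eigenvalues are the principal
curvatures. -/
def shapeOperator (ρ : ℝ) (F : ℝ → ℝ → E4) (s t : ℝ) (η : E4) : Matrix (Fin 2) (Fin 2) ℝ :=
  (firstForm ρ F s t)⁻¹ * secondForm ρ F s t η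

/-- Mean curvature `H = trace A_η / 2`. -/
def meanCurvature (ρ : ℝ) (F : ℝ → ℝ → E4) (s t : ℝ) (η : E4) : ℝ :=
  (shapeOperator ρ F s t η).trace / 2

/-- Gaussian curvature `K = det A_η + ρ`. -/
def gaussCurvature (ρ : ℝ) (F : ℝ → ℝ → E4) (s t : ℝ) (η : E4) : ℝ :=
  (shapeOperator ρ F s t η).det + ρ

/-- Skew curvature `2 √(H² - K + ρ)`. -/
def skewCurvature (ρ : ℝ) (F : ℝ → ℝ → E4) (s t : ℝ) (η : E4) : ℝ :=
  2 * Real.sqrt (meanCurvature ρ F s t η ^ 2 - gaussCurvature ρ F s t η + ρ)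

/-- The surface `F` on `I × ℝ` has constant skew curvature `c` (for either choice of the unit
normal). -/
def HasConstantSkewCurvature (ρ : ℝ) (I : Set ℝ) (F : ℝ → ℝ → E4) (c : ℝ) : Prop :=
  ∀ s ∈ I, ∀ t, (∃ η, IsUnitNormal ρ F s t η) ∧
    ∀ η, IsUnitNormal ρ F s t η → skewCurvature ρ F s t η = c

/-- The binormal evolution surface `(s, t) ↦ φ_t (γ(s))`. -/
def evolutionSurface (φ : ℝ → E4 → E4) (γ : ℝ → E4) : ℝ → ℝ → E4 := fun s t => φ t (γ s)

end SkewCurv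

end

open SkewCurv

namespace SkewCurv

/-! ### The ambient bilinear form -/

/-! Since `γ` lies in `M2 ρ`, the binormal is `ε e2` with a constant sign `ε`. Put `f = exp (μ κ)`
and `W = ρμf γ + μf' T - (κμ - 1)f N`. By the Frenet equations the tangential part of `W'` is the
Euler–Lagrange expression and the normal part is `f' - μκ'f`, so `W` is a constant vector, and `⟨γ,
W⟩` differs from `μf` by a constant, which is zero if `ρ ≠ 0`. With `w = ε W`, the infinitesimal
rotation `x ↦ ⟨x, w⟩ e2 - x₂ w + c e2` therefore restricts to `μ f B` along `γ`
(`IsPlanarFrenetCurve.exists_rotField`).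

The linear part `G` of this field satisfies `G³ = -⟨w, w⟩ G`, so its flow is a quadratic polynomial
in `G` with explicit coefficients. This gives completeness and, with the fixed points of the flow,
the rotation group (`IsFlow.isRotationGroup`).

Uniqueness rests on `⟨X y - X x, y - x⟩ = 0` for Killing fields (`IsKillingField.form_sub_sub`): a
difference of two extensions vanishes on `γ`, and this identity forces it to vanish everywhere
(`eqOn_of_eq_on_curve`).

On the surface the parameters `s`, `t` are principal. The profile direction has curvature `κ`, and
the orbit direction has `-⟨N, w⟩ / g` with `g = ⟨γ, w⟩ + c`, which equals `κ - 1/μ` because of the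
normal component of `W`. The difference is `1/μ` up to the sign of the unit normal
(`IsPlanarFrenetCurve.hasConstantSkewCurvature`). -/

theorem form_comm (ρ : ℝ) (u v : E4) : form ρ u v = form ρ v u := by
  simp only [form]; ring

theorem form_add_left (ρ : ℝ) (u v w : E4) : form ρ (u + v) w = form ρ u w + form ρ v w := by
  simp only [form, Pi.add_apply]; ring

theorem form_sub_left (ρ : ℝ) (u v w : E4) : form ρ (u - v) w = form ρ u w - form ρ v w := by
  simp only [form, Pi.sub_apply]; ring

theorem form_smul_left (ρ a : ℝ) (u w : E4) : form ρ (a • u) w = a * form ρ u w := by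
  simp only [form, Pi.smul_apply, smul_eq_mul]; ring

theorem form_add_right (ρ : ℝ) (u v w : E4) : form ρ u (v + w) = form ρ u v + form ρ u w := by
  simp only [form, Pi.add_apply]; ring

theorem form_sub_right (ρ : ℝ) (u v w : E4) : form ρ u (v - w) = form ρ u v - form ρ u w := by
  simp only [form, Pi.sub_apply]; ring

theorem form_smul_right (ρ a : ℝ) (u w : E4) : form ρ u (a • w) = a * form ρ u w := by
  simp only [form, Pi.smul_apply, smul_eq_mul]; ring

theorem form_zero_left (ρ : ℝ) (w : E4) : form ρ 0 w = 0 := by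
  simp [form]

theorem hasDerivAt_form (ρ : ℝ) {u v : ℝ → E4} {u' v' : E4} {t : ℝ}
    (hu : HasDerivAt u u' t) (hv : HasDerivAt v v' t) :
    HasDerivAt (fun r => form ρ (u r) (v r)) (form ρ u' (v t) + form ρ (u t) v') t := by
  rw [hasDerivAt_pi] at hu hv
  have h := (((hu 0).mul (hv 0)).add ((hu 1).mul (hv 1))).add ((hu 2).mul (hv 2)) |>.add
    (((hu 3).mul (hv 3)).const_mul (if ρ < 0 then -1 else 1))
  refine h.congr_deriv ?_
  simp only [form]; ring

theorem contDiffOn_form (ρ : ℝ) {u v : ℝ → E4} {s : Set ℝ} {n : WithTop ℕ∞}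
    (hu : ContDiffOn ℝ n u s) (hv : ContDiffOn ℝ n v s) :
    ContDiffOn ℝ n (fun r => form ρ (u r) (v r)) s := by
  rw [contDiffOn_pi] at hu hv
  exact (((hu 0).mul (hv 0)).add ((hu 1).mul (hv 1))).add ((hu 2).mul (hv 2)) |>.add
    (contDiffOn_const.mul ((hu 3).mul (hv 3)))

/-- The unit vector of `ℝ⁴` normal to `M²(ρ)` in `M³(ρ)`. -/
def e2 : E4 := Pi.single 2 1

theorem e2_apply_two : e2 2 = 1 := by simp [e2]

theorem e2_apply_three : e2 3 = 0 := by simp [e2]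

theorem form_e2_right (ρ : ℝ) (u : E4) : form ρ u e2 = u 2 := by
  simp [form, e2]

theorem form_e2_left (ρ : ℝ) (u : E4) : form ρ e2 u = u 2 := by
  rw [form_comm, form_e2_right]

/-- Expansion of a `3`-vector in a basis that is orthonormal for a diagonal form. -/
theorem expansion_of_orthonormal (a δ r : ℝ) (T N g v : Fin 3 → ℝ)
    (hr : r * a = 1)
    (hTT : T 0 * T 0 + T 1 * T 1 + δ * (T 2 * T 2) = 1)
    (hNN : N 0 * N 0 + N 1 * N 1 + δ * (N 2 * N 2) = 1)
    (hgg : g 0 * g 0 + g 1 * g 1 + δ * (g 2 * g 2) = a)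
    (hTN : T 0 * N 0 + T 1 * N 1 + δ * (T 2 * N 2) = 0)
    (hTg : T 0 * g 0 + T 1 * g 1 + δ * (T 2 * g 2) = 0)
    (hNg : N 0 * g 0 + N 1 * g 1 + δ * (N 2 * g 2) = 0) :
    v = (v 0 * T 0 + v 1 * T 1 + δ * (v 2 * T 2)) • T
      + (v 0 * N 0 + v 1 * N 1 + δ * (v 2 * N 2)) • N
      + (r * (v 0 * g 0 + v 1 * g 1 + δ * (v 2 * g 2))) • g := by
  let A : Matrix (Fin 3) (Fin 3) ℝ := Matrix.of ![T, N, g]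
  let D : Matrix (Fin 3) (Fin 3) ℝ :=
    !![T 0, N 0, r * g 0; T 1, N 1, r * g 1; δ * T 2, δ * N 2, δ * (r * g 2)]
  have hAD : A * D = 1 := by
    ext i j
    fin_cases i <;> fin_cases j <;>
      simp [A, D, Matrix.mul_apply, Fin.sum_univ_three] <;>
      first
        | linear_combination hTT
        | linear_combination hNN
        | linear_combination r * hgg + hr
        | linear_combination hTN
        | linear_combination hTg
        | linear_combination hNg
        | linear_combination r * hTg
        | linear_combination r * hNg
  -- Orthonormality says that `D` is a right inverse of `A`; for square matrices it is then a left
  -- inverse, which is the completeness of the basis.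
  have hDA : D * A = 1 := mul_eq_one_comm.mp hAD
  have h := fun i j => congrFun (congrFun hDA i) j
  simp only [Matrix.mul_apply, Fin.sum_univ_three, A, D] at h
  funext j
  have h0 := h 0 j
  have h1 := h 1 j
  have h2 := h 2 j
  fin_cases j <;> simp [Matrix.one_apply] at h0 h1 h2 ⊢ <;>
    linear_combination (-v 0) * h0 - v 1 * h1 - v 2 * h2

/-- For `ρ ≠ 0` the position vector `x` has square `1 / ρ` and completes `T`, `N`, `e2` to an
orthogonal basis. For `ρ = 0` its term drops out and the fourth coordinate has to vanish by
hypothesis. Keeping the factor `ρ` treats all space forms by one formula. -/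
theorem frame_expansion {ρ : ℝ} {x T N v : E4} (hx : x ∈ M2 ρ) (hT : T ∈ tangent2 ρ x)
    (hN : N ∈ tangent2 ρ x) (hTT : form ρ T T = 1) (hNN : form ρ N N = 1)
    (hTN : form ρ T N = 0) (hv : ρ = 0 → v 3 = 0) :
    v = form ρ v T • T + form ρ v N • N + (ρ * form ρ v x) • x + v 2 • e2 := by
  obtain ⟨hx, hx2⟩ := hx
  obtain ⟨hT, hT2⟩ := hT
  obtain ⟨hN, hN2⟩ := hN
  let p : E4 → Fin 3 → ℝ := fun u => ![u 0, u 1, u 3]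
  by_cases hρ : ρ = 0
  · subst hρ
    simp only [tangent, M3, if_true, Set.mem_ofPred_eq] at hx hT hN
    have h := expansion_of_orthonormal 1 1 1 (p T) (p N) ![0, 0, 1] (p v) (by norm_num)
      (by simpa [p, form, hT2] using hTT) (by simpa [p, form, hN2] using hNN) (by simp)
      (by simpa [p, form, hN2] using hTN) (by simp [p, hT]) (by simp [p, hN])
    have h0 := congrFun h 0
    have h1 := congrFun h 1
    simp [p, hT, hN] at h0 h1
    funext j
    fin_cases j
    · simpa [form, hT2, hN2, hT, hN, e2] using h0
    · simpa [form, hT2, hN2, hT, hN, e2] using h1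
    · simp [form, hT2, hN2, e2]
    · simp [hv, hT, hN, e2]
  · simp only [tangent, M3, hρ, if_false, Set.mem_ofPred_eq] at hx hT hN
    have h := expansion_of_orthonormal (1 / ρ) (if ρ < 0 then -1 else 1) ρ (p T) (p N) (p x) (p v)
      (by field_simp)
      (by simp only [form, hT2, mul_zero, add_zero] at hTT; exact hTT)
      (by simp only [form, hN2, mul_zero, add_zero] at hNN; exact hNN)
      (by have := hx.1; simp only [form, hx2, mul_zero, add_zero] at this; exact this)
      (by simp only [form, hN2, mul_zero, add_zero] at hTN; exact hTN)
      (by rw [form_comm] at hT; simp only [form, hx2, mul_zero, add_zero] at hT; exact hT)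
      (by rw [form_comm] at hN; simp only [form, hx2, mul_zero, add_zero] at hN; exact hN)
    have h0 := congrFun h 0
    have h1 := congrFun h 1
    have h2 := congrFun h 2
    simp [p] at h0 h1 h2
    funext j
    fin_cases j
    · simpa [form, hT2, hN2, hx2, e2] using h0
    · simpa [form, hT2, hN2, hx2, e2] using h1
    · simp [form, hT2, hN2, hx2, e2]
    · simpa [form, hT2, hN2, hx2, e2] using h2

/-! ### Points and tangent vectors of the space forms -/

theorem mem_M3_zero {x : E4} : x ∈ M3 0 ↔ x 3 = 0 := by simp [M3]

theorem mem_M3_iff {ρ : ℝ} (hρ : ρ ≠ 0) {x : E4} :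
    x ∈ M3 ρ ↔ form ρ x x = 1 / ρ ∧ (ρ < 0 → 0 < x 3) := by simp [M3, hρ]

theorem mem_tangent_zero {x v : E4} : v ∈ tangent 0 x ↔ v 3 = 0 := by simp [tangent]

theorem mem_tangent_iff {ρ : ℝ} (hρ : ρ ≠ 0) {x v : E4} :
    v ∈ tangent ρ x ↔ form ρ x v = 0 := by simp [tangent, hρ]

theorem mul_form_self {ρ : ℝ} {x : E4} (hx : x ∈ M3 ρ) (hρ : ρ ≠ 0) : ρ * form ρ x x = 1 := by
  rw [((mem_M3_iff hρ).1 hx).1]; field_simp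

theorem mul_form_of_mem_tangent {ρ : ℝ} {x v : E4} (hv : v ∈ tangent ρ x) :
    ρ * form ρ v x = 0 := by
  by_cases hρ : ρ = 0
  · simp [hρ]
  · rw [form_comm, (mem_tangent_iff hρ).1 hv, mul_zero]

/-- The projection alters `w` by a multiple of `x` only, which is invisible to tangent vectors;
covariant derivatives can thus be replaced by derivatives in `ℝ⁴`. -/
theorem form_proj_of_mem_tangent {ρ : ℝ} {x v w : E4} (hv : v ∈ tangent ρ x) :
    form ρ (proj ρ x w) v = form ρ w v := by
  rw [proj, form_sub_left, form_smul_left, form_comm ρ x v]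
  linear_combination (-form ρ w x) * mul_form_of_mem_tangent hv

/-- The device for differentiating identities that are known only on an open set. -/
theorem eq_zero_of_hasDerivAt {E : Type*} [NormedAddCommGroup E] [NormedSpace ℝ E]
    {I : Set ℝ} (hI : IsOpen I) {f : ℝ → E} {a f' : E} {s : ℝ} (hs : s ∈ I)
    (h : ∀ r ∈ I, f r = a) (hf : HasDerivAt f f' s) : f' = 0 :=
  hf.unique ((hasDerivAt_const s a).congr_of_eventuallyEq
    (Filter.eventuallyEq_of_mem (hI.mem_nhds hs) h))

/-! ### Killing fields -/

theorem IsKillingField.form_fderiv_self {ρ : ℝ} {X : E4 → E4} (hX : IsKillingField ρ X) {x v : E4}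
    (hx : x ∈ M3 ρ) (hv : v ∈ SkewCurv.tangent ρ x) : form ρ (fderiv ℝ X x v) v = 0 := by
  have h := hX.killing x hx v hv v hv
  rw [form_comm ρ v, form_proj_of_mem_tangent hv] at h
  linarith

theorem IsKillingField.hasDerivAt_comp {ρ : ℝ} {X : E4 → E4} (hX : IsKillingField ρ X)
    {c : ℝ → E4} {c' : E4} {t : ℝ} (hc : HasDerivAt c c' t) :
    HasDerivAt (fun r => X (c r)) (fderiv ℝ X (c t) c') t :=
  ((hX.smooth.differentiable (by simp)) (c t)).hasFDerivAt.comp_hasDerivAt t hc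

theorem eq_of_hasDerivAt_zero {U : Set ℝ} (hU : Set.Icc 0 1 ⊆ U) {h : ℝ → ℝ}
    (hh : ∀ t ∈ U, HasDerivAt h 0 t) : h 1 = h 0 :=
  constant_of_has_deriv_right_zero
    (fun t ht => (hh t (hU ht)).continuousAt.continuousWithinAt)
    (fun t ht => (hh t (hU ⟨ht.1, ht.2.le⟩)).hasDerivWithinAt) 1 ⟨zero_le_one, le_rfl⟩

/-- Along the chord between two points that are not antipodal, the degree one homogeneous extension
of a Killing field has constant product with the direction. -/
theorem IsKillingField.form_sub_sub_of_lt {ρ : ℝ} {X : E4 → E4} (hX : IsKillingField ρ X)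
    (hρ : ρ ≠ 0) {x y : E4} (hx : x ∈ M3 ρ) (hy : y ∈ M3 ρ) (ha : -1 < ρ * form ρ x y) :
    form ρ (X y - X x) (y - x) = 0 := by
  set v := y - x with hv
  let P : ℝ → E4 := fun t => x + t • v
  let Q : ℝ → ℝ := fun t => ρ * form ρ (P t) (P t)
  let n : ℝ → ℝ := fun t => Real.sqrt (Q t)
  let c : ℝ → E4 := fun t => (n t)⁻¹ • P t
  let U : Set ℝ := {t | 0 < Q t} ∩ {t | ρ < 0 → 0 < P t 3}
  have hP : ∀ t, HasDerivAt P v t := fun t => by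
    exact (((hasDerivAt_id t).smul_const v).const_add x).congr_deriv (one_smul _ _)
  have hQ : ∀ t, HasDerivAt Q (2 * (ρ * form ρ (P t) v)) t := fun t => by
    refine ((hasDerivAt_form ρ (hP t) (hP t)).const_mul ρ).congr_deriv ?_
    rw [form_comm ρ v]; ring
  have hPc : Continuous P := continuous_iff_continuousAt.2 fun t => (hP t).continuousAt
  have hQc : Continuous Q := continuous_iff_continuousAt.2 fun t => (hQ t).continuousAt
  have hUo : IsOpen U := by
    refine (isOpen_lt continuous_const hQc).inter ?_
    by_cases h : ρ < 0
    · simp only [h, true_imp_iff]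
      exact isOpen_lt continuous_const ((continuous_apply 3).comp hPc)
    · simp [h]
  have hUI : Set.Icc 0 1 ⊆ U := by
    rintro t ⟨h0, h1⟩
    constructor
    · have hxx := mul_form_self hx hρ
      have hyy := mul_form_self hy hρ
      -- This equals `(1 - 2t)² + 2t(1 - t)(1 + ρ⟨x, y⟩)`, positive on `[0, 1]` exactly because
      -- `ρ⟨x, y⟩ > -1`: the chord avoids the origin's null cone and projects radially to `M3 ρ`.
      have hq : Q t = (1 - t) ^ 2 + t ^ 2 + 2 * t * (1 - t) * (ρ * form ρ x y) := by
        simp only [Q, P, hv, form_add_left, form_add_right, form_smul_left, form_smul_right,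
          form_sub_left, form_sub_right, form_comm ρ y x]
        linear_combination (1 - t) ^ 2 * hxx + t ^ 2 * hyy
      change 0 < Q t
      rw [hq]
      have h2 : 0 ≤ t * (1 - t) := mul_nonneg h0 (by linarith)
      have h3 : 0 ≤ t * (1 - t) * (ρ * form ρ x y + 1) := mul_nonneg h2 (by linarith)
      rcases eq_or_lt_of_le h2 with h | h
      · nlinarith [sq_nonneg (1 - 2 * t)]
      · have : 0 < t * (1 - t) * (ρ * form ρ x y + 1) := mul_pos h (by linarith)
        nlinarith [sq_nonneg (1 - 2 * t)]
    · intro hneg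
      have hx3 := ((mem_M3_iff hρ).1 hx).2 hneg
      have hy3 := ((mem_M3_iff hρ).1 hy).2 hneg
      have : P t 3 = (1 - t) * x 3 + t * y 3 := by simp [P, hv]; ring
      rw [this]
      rcases eq_or_lt_of_le h0 with h | h
      · rw [← h]; simpa using hx3
      · have := mul_pos h hy3
        have := mul_nonneg (sub_nonneg.2 h1) hx3.le
        linarith
  have hnpos : ∀ t ∈ U, 0 < n t := fun t ht => Real.sqrt_pos.2 ht.1
  have hcM : ∀ t ∈ U, c t ∈ M3 ρ := fun t ht => by
    rw [mem_M3_iff hρ]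
    have hn := hnpos t ht
    have hnn : n t * n t = ρ * form ρ (P t) (P t) := Real.mul_self_sqrt ht.1.le
    refine ⟨?_, fun h => ?_⟩
    · simp only [c, form_smul_left, form_smul_right]
      have : form ρ (P t) (P t) ≠ 0 := fun h => by
        rw [h, mul_zero] at hnn; exact (mul_pos hn hn).ne' hnn
      rw [← mul_assoc, ← mul_inv, hnn]
      field_simp
    · exact mul_pos (inv_pos.2 hn) (ht.2 h)
  have hh : ∀ t ∈ U, HasDerivAt (fun r => n r * form ρ (X (c r)) v) 0 t := fun t ht => by
    have hn := (hnpos t ht).ne'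
    have hnd : HasDerivAt n (2 * (ρ * form ρ (P t) v) / (2 * n t)) t := (hQ t).sqrt ht.1.ne'
    set n' := 2 * (ρ * form ρ (P t) v) / (2 * n t)
    have hcd : HasDerivAt c ((n t)⁻¹ • v + (-n' / n t ^ 2) • P t) t :=
      (hnd.inv hn).smul (hP t)
    set c' := (n t)⁻¹ • v + (-n' / n t ^ 2) • P t with hc'
    -- Product rule for `P = n c`.
    have hvc : v = n t • c' + n' • c t := by
      funext j
      simp only [hc', c, Pi.add_apply, Pi.smul_apply, smul_eq_mul]
      field_simp
      ring
    have hXd := hX.hasDerivAt_comp hcd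
    have h1 : form ρ c' (c t) + form ρ (c t) c' = 0 :=
      eq_zero_of_hasDerivAt hUo ht (fun r hr => ((mem_M3_iff hρ).1 (hcM r hr)).1)
        (hasDerivAt_form ρ hcd hcd)
    have h2 : form ρ (fderiv ℝ X (c t) c') (c t) + form ρ (X (c t)) c' = 0 := by
      refine eq_zero_of_hasDerivAt (a := 0) hUo ht (fun r hr => ?_) (hasDerivAt_form ρ hXd hcd)
      have := (mem_tangent_iff hρ).1 (hX.tangent _ (hcM r hr))
      rwa [form_comm] at this
    have h3 : form ρ (X (c t)) (c t) = 0 := by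
      rw [form_comm]; exact (mem_tangent_iff hρ).1 (hX.tangent _ (hcM t ht))
    have hc't : c' ∈ SkewCurv.tangent ρ (c t) := by
      rw [mem_tangent_iff hρ]; rw [form_comm ρ c'] at h1; linarith
    have h4 := hX.form_fderiv_self (hcM t ht) hc't
    refine (hnd.mul (hasDerivAt_form ρ hXd (hasDerivAt_const t v))).congr_deriv ?_
    have h5 : form ρ (X (c t)) 0 = 0 := by rw [form_comm, form_zero_left]
    rw [h5, add_zero, hvc]
    simp only [form_add_right, form_smul_right]
    -- After substituting for `v`, the squared terms vanish by tangency of `X` and by the Killing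
    -- equation on `c'`; the mixed terms cancel by the derivative of `⟨X(c), c⟩ = 0`.
    linear_combination n' * n' * h3 + n t * n t * h4 + n t * n' * h2
  have h := eq_of_hasDerivAt_zero hUI hh
  have hn1 : n 1 = 1 := by
    simp only [n, Q, P, hv, one_smul, add_sub_cancel, mul_form_self hy hρ, Real.sqrt_one]
  have hn0 : n 0 = 1 := by
    simp only [n, Q, P, zero_smul, add_zero, mul_form_self hx hρ, Real.sqrt_one]
  simp only [c, hn1, hn0, inv_one, one_smul, one_mul, P, zero_smul, add_zero] at h
  rw [form_sub_left, ← h, hv, add_sub_cancel, sub_self]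

/-- A Killing field preserves distances between points to first order. -/
theorem IsKillingField.form_sub_sub {ρ : ℝ} {X : E4 → E4} (hX : IsKillingField ρ X)
    {x y : E4} (hx : x ∈ M3 ρ) (hy : y ∈ M3 ρ) : form ρ (X y - X x) (y - x) = 0 := by
  by_cases hρ : ρ = 0
  · subst hρ
    have hx3 := mem_M3_zero.1 hx
    have hy3 := mem_M3_zero.1 hy
    have hP : ∀ t, HasDerivAt (fun t : ℝ => x + t • (y - x)) (y - x) t := fun t => by
      simpa using ((hasDerivAt_id t).smul_const (y - x)).const_add x
    have h := eq_of_hasDerivAt_zero (Set.subset_univ _)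
      (h := fun r => form 0 (X (x + r • (y - x))) (y - x)) fun t _ => by
        refine (hasDerivAt_form 0 (hX.hasDerivAt_comp (hP t))
          (hasDerivAt_const t (y - x))).congr_deriv ?_
        rw [hX.form_fderiv_self (mem_M3_zero.2 (by simp [hx3, hy3]))
          (mem_tangent_zero.2 (by simp [hx3, hy3])), form_comm, form_zero_left, add_zero]
    simp only [one_smul, add_sub_cancel, zero_smul, add_zero] at h
    rw [form_sub_left, h, sub_self]
  have hx' := (mem_M3_iff hρ).1 hx
  have hy' := (mem_M3_iff hρ).1 hy
  rcases lt_or_gt_of_ne hρ with hneg | hpos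
  · refine hX.form_sub_sub_of_lt hρ hx hy ?_
    have hx3 := hx'.2 hneg
    have hy3 := hy'.2 hneg
    have hxx := hx'.1
    have hyy := hy'.1
    have hr : 1 / ρ < 0 := one_div_neg.2 hneg
    -- Reversed Cauchy–Schwarz on the upper sheet: the spatial product is smaller than `x₃ y₃`.
    -- Hence `ρ⟨x, y⟩ > 0`.
    have : form ρ x y < 0 := by
      simp only [form, hneg, if_true] at hxx hyy ⊢
      have hcs : (x 0 * y 0 + x 1 * y 1 + x 2 * y 2) ^ 2
          ≤ (x 0 ^ 2 + x 1 ^ 2 + x 2 ^ 2) * (y 0 ^ 2 + y 1 ^ 2 + y 2 ^ 2) := by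
        nlinarith [sq_nonneg (x 0 * y 1 - x 1 * y 0), sq_nonneg (x 0 * y 2 - x 2 * y 0),
          sq_nonneg (x 1 * y 2 - x 2 * y 1)]
      have hlt : (x 0 ^ 2 + x 1 ^ 2 + x 2 ^ 2) * (y 0 ^ 2 + y 1 ^ 2 + y 2 ^ 2)
          < x 3 ^ 2 * y 3 ^ 2 :=
        mul_lt_mul'' (by nlinarith) (by nlinarith) (by positivity) (by positivity)
      have := abs_lt_of_sq_lt_sq (a := x 0 * y 0 + x 1 * y 1 + x 2 * y 2) (b := x 3 * y 3)
        (by rw [mul_pow]; linarith) (by positivity)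
      linarith [(abs_lt.1 this).2]
    have := mul_pos_of_neg_of_neg hneg this
    linarith
  · by_cases ha : -1 < ρ * form ρ x y
    · exact hX.form_sub_sub_of_lt hρ hx hy ha
    have hxx := mul_form_self hx hρ
    have hyy := mul_form_self hy hρ
    -- On the sphere the only remaining case is `y = -x`; the chord is then a multiple of both `x`
    -- and `y`, to which `X x` and `X y` are respectively orthogonal.
    have hle : form ρ (x + y) (x + y) ≤ 0 := by
      by_contra! h
      have := mul_pos hpos h
      simp only [form_add_left, form_add_right, form_comm ρ y x] at this
      linarith
    have hyx : y = -x := by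
      simp only [form, not_lt.2 hpos.le, if_false, Pi.add_apply, one_mul] at hle
      funext j
      have h0 := mul_self_nonneg (x 0 + y 0)
      have h1 := mul_self_nonneg (x 1 + y 1)
      have h2 := mul_self_nonneg (x 2 + y 2)
      have h3 := mul_self_nonneg (x 3 + y 3)
      have : (x j + y j) * (x j + y j) = 0 := by
        fin_cases j <;> simp <;> nlinarith
      have := mul_self_eq_zero.1 this
      simp only [Pi.neg_apply]; linarith
    have h1 := (mem_tangent_iff hρ).1 (hX.tangent x hx)
    have h2 := (mem_tangent_iff hρ).1 (hX.tangent y hy)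
    rw [form_comm] at h1 h2
    have h3 : y - x = (-2 : ℝ) • x := by rw [hyx]; funext j; simp; ring
    have h4 : x = (-1 : ℝ) • y := by rw [hyx]; simp
    rw [form_sub_left, h3, form_smul_right, form_smul_right, h1]
    nth_rewrite 1 [h4]
    rw [form_smul_right, h2]; ring

/-! ### The Frenet equations of a planar curve -/

namespace IsPlanarFrenetCurve

variable {ρ : ℝ} {I : Set ℝ} {γ N B : ℝ → E4} {κ : ℝ → ℝ}

theorem hasDerivAt_curve (h : IsPlanarFrenetCurve ρ I γ N B κ) (hI : IsOpen I) {s : ℝ}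
    (hs : s ∈ I) : HasDerivAt γ (deriv γ s) s :=
  ((h.smooth_curve.differentiableOn (by simp)).differentiableAt (hI.mem_nhds hs)).hasDerivAt

theorem contDiffOn_deriv (h : IsPlanarFrenetCurve ρ I γ N B κ) (hI : IsOpen I) :
    ContDiffOn ℝ ∞ (deriv γ) I :=
  ((contDiffOn_infty_iff_deriv_of_isOpen hI).1 h.smooth_curve).2

theorem contDiffOn_deriv_deriv (h : IsPlanarFrenetCurve ρ I γ N B κ) (hI : IsOpen I) :
    ContDiffOn ℝ ∞ (deriv (deriv γ)) I :=
  ((contDiffOn_infty_iff_deriv_of_isOpen hI).1 (h.contDiffOn_deriv hI)).2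

theorem hasDerivAt_deriv (h : IsPlanarFrenetCurve ρ I γ N B κ) (hI : IsOpen I) {s : ℝ}
    (hs : s ∈ I) : HasDerivAt (deriv γ) (deriv (deriv γ) s) s :=
  (((h.contDiffOn_deriv hI).differentiableOn (by simp)).differentiableAt
    (hI.mem_nhds hs)).hasDerivAt

theorem curve_apply_two (h : IsPlanarFrenetCurve ρ I γ N B κ) {s : ℝ} (hs : s ∈ I) :
    γ s 2 = 0 := (h.mem s hs).2

theorem tangent_mem (h : IsPlanarFrenetCurve ρ I γ N B κ) (hI : IsOpen I) {s : ℝ}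
    (hs : s ∈ I) : deriv γ s ∈ tangent2 ρ (γ s) := by
  have hd := h.hasDerivAt_curve hI hs
  have hd' := hasDerivAt_pi.1 hd
  refine ⟨?_, eq_zero_of_hasDerivAt hI hs (fun r hr => h.curve_apply_two hr) (hd' 2)⟩
  by_cases hρ : ρ = 0
  · subst hρ
    exact mem_tangent_zero.2
      (eq_zero_of_hasDerivAt hI hs (fun r hr => mem_M3_zero.1 (h.mem r hr).1) (hd' 3))
  · rw [mem_tangent_iff hρ]
    have := eq_zero_of_hasDerivAt hI hs (fun r hr => ((mem_M3_iff hρ).1 (h.mem r hr).1).1)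
      (hasDerivAt_form ρ hd hd)
    rw [form_comm ρ (deriv γ s)] at this
    linarith

/-- Derivative of `ρ⟨T, γ⟩ = 0`. It identifies the part of `γ''` that `proj` removes as `-ρ γ`. -/
theorem mul_form_deriv_deriv (h : IsPlanarFrenetCurve ρ I γ N B κ) (hI : IsOpen I) {s : ℝ}
    (hs : s ∈ I) : ρ * form ρ (deriv (deriv γ) s) (γ s) = -ρ := by
  have := eq_zero_of_hasDerivAt hI hs
    (fun r hr => mul_form_of_mem_tangent (h.tangent_mem hI hr).1)
    ((hasDerivAt_form ρ (h.hasDerivAt_deriv hI hs) (h.hasDerivAt_curve hI hs)).const_mul ρ)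
  rw [h.arc_length s hs] at this
  linarith

/-- First Frenet equation. -/
theorem hasDerivAt_tangent (h : IsPlanarFrenetCurve ρ I γ N B κ) (hI : IsOpen I) {s : ℝ}
    (hs : s ∈ I) : HasDerivAt (deriv γ) (κ s • N s - ρ • γ s) s := by
  refine (h.hasDerivAt_deriv hI hs).congr_deriv ?_
  have := h.curvature s hs
  rw [proj, h.mul_form_deriv_deriv hI hs] at this
  rw [← this, neg_smul]; abel

/-- Second Frenet equation. -/
theorem hasDerivAt_normal (h : IsPlanarFrenetCurve ρ I γ N B κ) (hI : IsOpen I) {s : ℝ}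
    (hs : s ∈ I) : HasDerivAt N (-κ s • deriv γ s) s := by
  have hd : HasDerivAt N (deriv N s) s :=
    ((h.smooth_normal.differentiableOn (by simp)).differentiableAt (hI.mem_nhds hs)).hasDerivAt
  refine hd.congr_deriv ?_
  have hd' := hasDerivAt_pi.1 hd
  have hTan := h.normal_tangent s hs
  have h2 : deriv N s 2 = 0 :=
    eq_zero_of_hasDerivAt hI hs (fun r hr => (h.normal_tangent r hr).2) (hd' 2)
  have hNN : form ρ (deriv N s) (N s) = 0 := by
    have := eq_zero_of_hasDerivAt hI hs h.normal_unit (hasDerivAt_form ρ hd hd)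
    rw [form_comm ρ (N s)] at this
    linarith
  have hNT : form ρ (deriv N s) (deriv γ s) = -κ s := by
    have := eq_zero_of_hasDerivAt hI hs h.normal_orth
      (hasDerivAt_form ρ (h.hasDerivAt_tangent hI hs) hd)
    rw [form_sub_left, form_smul_left, form_smul_left, h.normal_unit s hs,
      form_comm ρ (γ s), mul_form_of_mem_tangent hTan.1, form_comm ρ (deriv γ s)] at this
    linarith
  have hNg : ρ * form ρ (deriv N s) (γ s) = 0 := by
    have := eq_zero_of_hasDerivAt hI hs
      (fun r hr => mul_form_of_mem_tangent (h.normal_tangent r hr).1)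
      ((hasDerivAt_form ρ hd (h.hasDerivAt_curve hI hs)).const_mul ρ)
    rw [form_comm ρ (N s), h.normal_orth s hs] at this
    linarith
  have h3 : ρ = 0 → deriv N s 3 = 0 := by
    rintro rfl
    exact eq_zero_of_hasDerivAt hI hs
      (fun r hr => mem_tangent_zero.1 (h.normal_tangent r hr).1) (hd' 3)
  rw [frame_expansion (h.mem s hs) (h.tangent_mem hI hs) hTan (h.arc_length s hs)
    (h.normal_unit s hs) (h.normal_orth s hs) h3, hNT, hNN, hNg, h2]
  simp

/-- Smoothness of `κ` is not part of the Frenet data; it follows from `κ = ⟨γ'', N⟩`. -/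
theorem contDiffOn_curvature (h : IsPlanarFrenetCurve ρ I γ N B κ) (hI : IsOpen I) :
    ContDiffOn ℝ ∞ κ I := by
  refine (contDiffOn_form ρ (h.contDiffOn_deriv_deriv hI) h.smooth_normal).congr fun s hs => ?_
  have hN := (h.normal_tangent s hs).1
  rw [← form_proj_of_mem_tangent hN, h.curvature s hs, form_smul_left, h.normal_unit s hs, mul_one]

/-- The binormal is one of the two constant unit normals of `M²(ρ)`. -/
theorem exists_binormal_eq (h : IsPlanarFrenetCurve ρ I γ N B κ) (hI : IsOpen I)
    (hc : IsPreconnected I) : ∃ ε : ℝ, ε * ε = 1 ∧ ∀ s ∈ I, B s = ε • e2 := by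
  have hB : ∀ s ∈ I, B s = B s 2 • e2 := fun s hs => by
    have hBt := h.binormal_tangent s hs
    have := frame_expansion (h.mem s hs) (h.tangent_mem hI hs) (h.normal_tangent s hs)
      (h.arc_length s hs) (h.normal_unit s hs) (h.normal_orth s hs) (v := B s)
      (by rintro rfl; exact mem_tangent_zero.1 hBt)
    rw [h.binormal_orth_tangent s hs, h.binormal_orth_normal s hs, mul_form_of_mem_tangent hBt]
      at this
    simpa using this
  have hsq : Set.EqOn ((fun s => B s 2) ^ 2) 1 I := fun s hs => by
    have := h.binormal_unit s hs
    rw [hB s hs, form_smul_left, form_e2_left] at this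
    simpa [e2, sq] using this
  have hcont : ContinuousOn (fun s => B s 2) I :=
    (continuous_apply (2 : Fin 4)).comp_continuousOn h.smooth_binormal.continuousOn
  rcases hc.eq_one_or_eq_neg_one_of_sq_eq hcont hsq with h1 | h1
  · refine ⟨1, by norm_num, fun s hs => ?_⟩
    rw [hB s hs, show B s 2 = 1 from h1 hs]
  · refine ⟨-1, by norm_num, fun s hs => ?_⟩
    rw [hB s hs, show B s 2 = -1 from h1 hs]

end IsPlanarFrenetCurve

/-! ### Uniqueness of the Killing extension -/

theorem exists_mem_M3_apply_two_ne_zero (ρ : ℝ) : ∃ y ∈ M3 ρ, y 2 ≠ 0 := by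
  rcases lt_trichotomy ρ 0 with hρ | rfl | hρ
  · have h1 : 0 < 1 - 1 / ρ := by linarith [one_div_neg.2 hρ]
    refine ⟨![0, 0, 1, Real.sqrt (1 - 1 / ρ)], (mem_M3_iff hρ.ne).2 ⟨?_, fun _ => ?_⟩, by simp⟩
    · have h2 := Real.mul_self_sqrt h1.le
      simp only [form, hρ, if_true, Matrix.cons_val]
      linarith
    · simpa using h1
  · exact ⟨e2, mem_M3_zero.2 e2_apply_three, by simp [e2]⟩
  · refine ⟨(Real.sqrt ρ)⁻¹ • e2, (mem_M3_iff hρ.ne').2 ⟨?_, fun h => absurd h hρ.not_gt⟩, ?_⟩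
    · rw [form_smul_left, form_e2_left, Pi.smul_apply, e2_apply_two, smul_eq_mul, mul_one,
        ← mul_inv, Real.mul_self_sqrt hρ.le, one_div]
    · simpa [e2] using (Real.sqrt_pos.2 hρ).ne'

/-- The difference `Z` vanishes on `γ`, so `⟨Z x, x - γ r⟩ = 0` for all `r`. Two derivatives in `r`
show that `Z x` is orthogonal to `T` and, where `κ ≠ 0`, to `N`; hence `Z x` is a multiple of `e2`.
The same identity then gives `Z x = 0` off `M2 ρ`, and comparison with a point off `M2 ρ` settles
the points on it. -/
theorem eqOn_of_eq_on_curve {ρ : ℝ} {I : Set ℝ} {γ N B : ℝ → E4} {κ : ℝ → ℝ}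
    (h : IsPlanarFrenetCurve ρ I γ N B κ) (hI : IsOpen I) {s : ℝ} (hs : s ∈ I) (hκ : κ s ≠ 0)
    {X Y : E4 → E4} (hX : IsKillingField ρ X) (hY : IsKillingField ρ Y)
    (hXY : ∀ r ∈ I, X (γ r) = Y (γ r)) : Set.EqOn X Y (M3 ρ) := by
  let Z : E4 → E4 := fun x => X x - Y x
  have hZ : ∀ x ∈ M3 ρ, ∀ y ∈ M3 ρ, form ρ (Z y - Z x) (y - x) = 0 := fun x hx y hy => by
    have h1 := hX.form_sub_sub hx hy
    have h2 := hY.form_sub_sub hx hy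
    simp only [Z, form_sub_left] at h1 h2 ⊢
    linarith
  have hZt : ∀ x ∈ M3 ρ, ρ * form ρ (Z x) x = 0 := fun x hx => by
    have h1 := mul_form_of_mem_tangent (hX.tangent x hx)
    have h2 := mul_form_of_mem_tangent (hY.tangent x hx)
    simp only [Z, form_sub_left]
    linarith
  have hZγ : ∀ x ∈ M3 ρ, ∀ r ∈ I, form ρ (Z x) (x - γ r) = 0 := fun x hx r hr => by
    have := hZ (γ r) (h.mem r hr).1 x hx
    rwa [show Z (γ r) = 0 from sub_eq_zero.2 (hXY r hr), sub_zero] at this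
  have hZ2 : ∀ x ∈ M3 ρ, Z x = Z x 2 • e2 := fun x hx => by
    have h0 : ∀ r ∈ I, form ρ (Z x) (γ r) = form ρ (Z x) x := fun r hr => by
      have := hZγ x hx r hr
      rw [form_sub_right] at this; linarith
    have h1 : ∀ r ∈ I, form ρ (Z x) (deriv γ r) = 0 := fun r hr => by
      have := eq_zero_of_hasDerivAt hI hr h0
        (hasDerivAt_form ρ (hasDerivAt_const r (Z x)) (h.hasDerivAt_curve hI hr))
      rwa [form_zero_left, zero_add] at this
    have h2 := eq_zero_of_hasDerivAt hI hs h1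
      (hasDerivAt_form ρ (hasDerivAt_const s (Z x)) (h.hasDerivAt_tangent hI hs))
    rw [form_zero_left, zero_add, form_sub_right, form_smul_right, form_smul_right, h0 s hs,
      hZt x hx, sub_zero] at h2
    have := frame_expansion (h.mem s hs) (h.tangent_mem hI hs) (h.normal_tangent s hs)
      (h.arc_length s hs) (h.normal_unit s hs) (h.normal_orth s hs) (v := Z x) (by
        rintro rfl
        have h1 := mem_tangent_zero.1 (hX.tangent x hx)
        have h2 := mem_tangent_zero.1 (hY.tangent x hx)
        simp [Z, h1, h2])
    rw [h1 s hs, (mul_eq_zero.1 h2).resolve_left hκ, h0 s hs, hZt x hx] at this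
    simpa using this
  have hprod : ∀ x ∈ M3 ρ, Z x 2 * x 2 = 0 := fun x hx => by
    have := hZγ x hx s hs
    rw [hZ2 x hx, form_smul_left, form_e2_left] at this
    simpa [h.curve_apply_two hs] using this
  have hzero : ∀ x ∈ M3 ρ, Z x 2 = 0 := fun x hx => by
    by_cases hx2 : x 2 = 0
    · obtain ⟨y, hy, hy2⟩ := exists_mem_M3_apply_two_ne_zero ρ
      have h1 := hZ x hx y hy
      rw [hZ2 x hx, hZ2 y hy, (mul_eq_zero.1 (hprod y hy)).resolve_right hy2, form_sub_left,
        form_smul_left, form_smul_left, form_e2_left] at h1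
      simpa [hx2, hy2] using h1
    · exact (mul_eq_zero.1 (hprod x hx)).resolve_right hx2
  intro x hx
  refine sub_eq_zero.1 (?_ : Z x = 0)
  rw [hZ2 x hx, hzero x hx, zero_smul]

/-! ### Infinitesimal rotations and their flows -/

/-- The infinitesimal rotation of `ℝ⁴` in the plane spanned by `w` and `e2`. -/
noncomputable def gen (ρ : ℝ) (w : E4) : E4 →ₗ[ℝ] E4 where
  toFun x := form ρ x w • e2 - x 2 • w
  map_add' x y := by rw [form_add_left, Pi.add_apply, add_smul, add_smul]; abel
  map_smul' a x := by
    rw [form_smul_left, Pi.smul_apply, smul_eq_mul, mul_smul, mul_smul, RingHom.id_apply, smul_sub]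

theorem gen_apply (ρ : ℝ) (w x : E4) : gen ρ w x = form ρ x w • e2 - x 2 • w := rfl

theorem gen_e2 (ρ : ℝ) {w : E4} (hw : w 2 = 0) : gen ρ w e2 = -w := by
  rw [gen_apply, form_e2_left, hw, e2_apply_two]; simp

theorem gen_self (ρ : ℝ) {w : E4} (hw : w 2 = 0) : gen ρ w w = form ρ w w • e2 := by
  rw [gen_apply, hw]; simp

/-- Skew-adjointness, the source of both the Killing equation and the isometry property. -/
theorem form_gen_left (ρ : ℝ) (w u v : E4) :
    form ρ (gen ρ w u) v = -form ρ u (gen ρ w v) := by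
  simp only [gen_apply, form_sub_left, form_sub_right, form_smul_left, form_smul_right,
    form_e2_left, form_e2_right, form_comm ρ w v]
  ring

/-- This cubic relation collapses the exponential series of `gen` to degree two, whatever the sign
of `⟨w, w⟩`; spherical, parabolic and hyperbolic rotations need no separate treatment. -/
theorem gen_gen_gen (ρ : ℝ) {w : E4} (hw : w 2 = 0) (x : E4) :
    gen ρ w (gen ρ w (gen ρ w x)) = -form ρ w w • gen ρ w x := by
  conv_lhs => rw [gen_apply ρ w x]
  simp only [map_sub, map_smul, map_neg, gen_e2 ρ hw, gen_self ρ hw]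
  rw [gen_apply]; module

theorem gen_gen_e2 (ρ : ℝ) {w : E4} (hw : w 2 = 0) :
    gen ρ w (gen ρ w e2) = -form ρ w w • e2 := by
  rw [gen_e2 ρ hw, map_neg, gen_self ρ hw, neg_smul]

/-- The affine rotation field `x ↦ gen x + c e2`. -/
noncomputable def rotField (ρ : ℝ) (w : E4) (c : ℝ) (x : E4) : E4 := gen ρ w x + c • e2

theorem gen_gen_rotField (ρ : ℝ) {w : E4} (hw : w 2 = 0) (c : ℝ) (x : E4) :
    gen ρ w (gen ρ w (rotField ρ w c x)) = -form ρ w w • rotField ρ w c x := by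
  simp only [rotField, map_add, map_smul]
  rw [gen_gen_gen ρ hw, gen_gen_e2 ρ hw]; module

/-- A polynomial in `gen` of degree two: every rotation generated by `gen` has this form. -/
noncomputable def rot (ρ : ℝ) (w : E4) (a b : ℝ) : E4 →ₗ[ℝ] E4 :=
  LinearMap.id + a • gen ρ w + b • (gen ρ w).comp (gen ρ w)

theorem rot_apply (ρ : ℝ) (w : E4) (a b : ℝ) (x : E4) :
    rot ρ w a b x = x + a • gen ρ w x + b • gen ρ w (gen ρ w x) := rfl

theorem form_rot_left (ρ : ℝ) (w : E4) (a b : ℝ) (u v : E4) :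
    form ρ (rot ρ w a b u) v = form ρ u (rot ρ w (-a) b v) := by
  simp only [rot_apply, form_add_left, form_add_right, form_smul_left, form_smul_right,
    form_gen_left]
  ring

/-- With `G = gen ρ w` and `G⁴ = -⟨w, w⟩ G²`, the product `(1 - aG + bG²)(1 + aG + bG²)` is `1 + (2b
- a² - ⟨w, w⟩ b²) G²`. -/
theorem rot_neg_rot (ρ : ℝ) {w : E4} (hw : w 2 = 0) {a b : ℝ}
    (hab : a ^ 2 + form ρ w w * b ^ 2 = 2 * b) (u : E4) : rot ρ w (-a) b (rot ρ w a b u) = u := by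
  have h : (2 * b - a ^ 2 - form ρ w w * b ^ 2) • gen ρ w (gen ρ w u) = 0 := by
    rw [show 2 * b - a ^ 2 - form ρ w w * b ^ 2 = 0 by linarith, zero_smul]
  simp only [rot_apply, map_add, map_smul, gen_gen_gen ρ hw]
  linear_combination (norm := module) h

theorem form_rot_rot (ρ : ℝ) {w : E4} (hw : w 2 = 0) {a b : ℝ}
    (hab : a ^ 2 + form ρ w w * b ^ 2 = 2 * b) (u v : E4) :
    form ρ (rot ρ w a b u) (rot ρ w a b v) = form ρ u v := by
  rw [form_rot_left, rot_neg_rot ρ hw hab]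

/-- The affine rotation generated by `rotField`. -/
noncomputable def affineRot (ρ : ℝ) (w : E4) (c a b : ℝ) (x : E4) : E4 :=
  rot ρ w a b x + c • (a • e2 - b • w)

theorem affineRot_eq (ρ : ℝ) {w : E4} (hw : w 2 = 0) (c a b : ℝ) (x : E4) :
    affineRot ρ w c a b x
      = x + a • rotField ρ w c x + b • gen ρ w (rotField ρ w c x) := by
  simp only [affineRot, rot_apply, rotField, map_add, map_smul, gen_e2 ρ hw]
  module

/-- The generalized sine and versed sine with `S' = 1 - d C`, `C' = S`. -/
theorem exists_sine_versine (d : ℝ) : ∃ S C : ℝ → ℝ, ContDiff ℝ ∞ S ∧ ContDiff ℝ ∞ C ∧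
    S 0 = 0 ∧ C 0 = 0 ∧ (∀ t, HasDerivAt S (1 - d * C t) t) ∧ ∀ t, HasDerivAt C (S t) t := by
  rcases lt_trichotomy d 0 with hd | rfl | hd
  · have hk := Real.sqrt_pos.2 (neg_pos.2 hd)
    have hkk := Real.mul_self_sqrt (neg_pos.2 hd).le
    set k := Real.sqrt (-d)
    have hdk : d = -(k * k) := by linarith
    have hlin : ∀ t, HasDerivAt (fun t => k * t) k t := fun t => by
      simpa using (hasDerivAt_id t).const_mul k
    refine ⟨fun t => Real.sinh (k * t) / k, fun t => (Real.cosh (k * t) - 1) / (k * k),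
      by fun_prop, by fun_prop, by simp, by simp, fun t => ?_, fun t => ?_⟩
    · refine ((hlin t).sinh.div_const k).congr_deriv ?_
      rw [hdk]; field_simp; ring
    · refine (((hlin t).cosh.sub_const 1).div_const (k * k)).congr_deriv ?_
      field_simp
  · refine ⟨fun t => t, fun t => t ^ 2 / 2, by fun_prop, by fun_prop, rfl, by simp,
      fun t => by simpa using! hasDerivAt_id t, fun t => ?_⟩
    simpa using (hasDerivAt_pow 2 t).div_const 2
  · have hk := Real.sqrt_pos.2 hd
    have hkk := Real.mul_self_sqrt hd.le
    set k := Real.sqrt d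
    have hlin : ∀ t, HasDerivAt (fun t => k * t) k t := fun t => by
      simpa using (hasDerivAt_id t).const_mul k
    refine ⟨fun t => Real.sin (k * t) / k, fun t => (1 - Real.cos (k * t)) / (k * k),
      by fun_prop, by fun_prop, by simp, by simp, fun t => ?_, fun t => ?_⟩
    · refine ((hlin t).sin.div_const k).congr_deriv ?_
      rw [← hkk]; field_simp; ring
    · refine (((hlin t).cos.const_sub 1).div_const (k * k)).congr_deriv ?_
      field_simp

/-- A first integral of the system for `S`, `C`; it is the condition under which `rot` is an
isometry. -/
theorem sine_sq_add_versine_sq {d : ℝ} {S C : ℝ → ℝ} (hS0 : S 0 = 0) (hC0 : C 0 = 0)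
    (hS : ∀ t, HasDerivAt S (1 - d * C t) t) (hC : ∀ t, HasDerivAt C (S t) t) (t : ℝ) :
    S t ^ 2 + d * C t ^ 2 = 2 * C t := by
  have h : ∀ t, HasDerivAt (fun t => S t ^ 2 + d * C t ^ 2 - 2 * C t) 0 t := fun t => by
    refine ((((hS t).pow 2).add (((hC t).pow 2).const_mul d)).sub
      ((hC t).const_mul 2)).congr_deriv ?_
    simp; ring
  have := is_const_of_deriv_eq_zero (fun t => (h t).differentiableAt) (fun t => (h t).deriv) t 0
  simp only [hS0, hC0] at this
  linarith

theorem hasDerivAt_affineRot (ρ : ℝ) {w : E4} (hw : w 2 = 0) (c : ℝ) {S C : ℝ → ℝ}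
    (hS : ∀ t, HasDerivAt S (1 - form ρ w w * C t) t) (hC : ∀ t, HasDerivAt C (S t) t)
    (x : E4) (t : ℝ) : HasDerivAt (fun r => affineRot ρ w c (S r) (C r) x)
      (rotField ρ w c (affineRot ρ w c (S t) (C t) x)) t := by
  simp only [affineRot_eq ρ hw]
  refine ((((hS t).smul_const (rotField ρ w c x)).const_add x).add
    ((hC t).smul_const (gen ρ w (rotField ρ w c x)))).congr_deriv ?_
  conv_rhs => rw [rotField]
  simp only [map_add, map_smul, gen_gen_rotField ρ hw]
  rw [rotField]
  module

/-- The field is affine, hence globally Lipschitz. This makes the explicit formula and the group law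
available for an arbitrary flow. -/
theorem eq_of_hasDerivAt_rotField (ρ : ℝ) (w : E4) (c : ℝ) {f g : ℝ → E4}
    (hf : ∀ t, HasDerivAt f (rotField ρ w c (f t)) t)
    (hg : ∀ t, HasDerivAt g (rotField ρ w c (g t)) t) (h : f 0 = g 0) : f = g := by
  let L : E4 →L[ℝ] E4 := LinearMap.toContinuousLinearMap (gen ρ w)
  have hL : LipschitzWith ‖L‖₊ (rotField ρ w c) := fun x y => by
    have := L.lipschitz x y
    rwa [← edist_add_right (L x) (L y) (c • e2)] at this
  exact ODE_solution_unique_univ (v := fun _ => rotField ρ w c) (s := fun _ => Set.univ)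
    (fun _ => hL.lipschitzOnWith) (fun t => ⟨hf t, Set.mem_univ _⟩)
    (fun t => ⟨hg t, Set.mem_univ _⟩) h

theorem rot_apply_three {w : E4} (hw : w 3 = 0) (ρ a b : ℝ) (x : E4) :
    rot ρ w a b x 3 = x 3 := by
  simp [rot_apply, gen_apply, hw, e2]

theorem affineRot_apply_three {w : E4} (hw : w 3 = 0) (ρ c a b : ℝ) (x : E4) :
    affineRot ρ w c a b x 3 = x 3 := by
  simp [affineRot, rot_apply_three hw, hw, e2]

theorem affineRot_zero_zero (ρ : ℝ) (w : E4) (c : ℝ) (x : E4) :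
    affineRot ρ w c 0 0 x = x := by
  simp [affineRot, rot_apply]

theorem affineRot_sub (ρ : ℝ) (w : E4) (c a b : ℝ) (x y : E4) :
    affineRot ρ w c a b x - affineRot ρ w c a b y = rot ρ w a b (x - y) := by
  simp [affineRot]

theorem affineRot_mem_M3 {ρ : ℝ} {w : E4} {c : ℝ} (hw : w 2 = 0) (hw3 : ρ = 0 → w 3 = 0)
    (hc : ρ ≠ 0 → c = 0) {S C : ℝ → ℝ} (hS0 : S 0 = 0) (hC0 : C 0 = 0)
    (hS : ∀ t, HasDerivAt S (1 - form ρ w w * C t) t) (hC : ∀ t, HasDerivAt C (S t) t)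
    {x : E4} (hx : x ∈ M3 ρ) (t : ℝ) : affineRot ρ w c (S t) (C t) x ∈ M3 ρ := by
  by_cases hρ : ρ = 0
  · subst hρ
    rw [mem_M3_zero, affineRot_apply_three (hw3 rfl)]
    exact mem_M3_zero.1 hx
  obtain ⟨hxx, hx3⟩ := (mem_M3_iff hρ).1 hx
  have hform : ∀ r, form ρ (affineRot ρ w c (S r) (C r) x) (affineRot ρ w c (S r) (C r) x)
      = 1 / ρ := fun r => by
    simp only [affineRot, hc hρ, zero_smul, add_zero]
    rw [form_rot_rot ρ hw (sine_sq_add_versine_sq hS0 hC0 hS hC r), hxx]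
  refine (mem_M3_iff hρ).2 ⟨hform t, fun hneg => ?_⟩
  -- A point with vanishing timelike coordinate has nonnegative square, not `1 / ρ < 0`. By
  -- continuity in `r` an orbit cannot leave the upper sheet.
  have hne : ∀ r, affineRot ρ w c (S r) (C r) x 3 ≠ 0 := fun r h0 => by
    have h1 := hform r
    simp only [form, h0, mul_zero, add_zero] at h1
    have := one_div_neg.2 hneg
    nlinarith [mul_self_nonneg (affineRot ρ w c (S r) (C r) x 0),
      mul_self_nonneg (affineRot ρ w c (S r) (C r) x 1),
      mul_self_nonneg (affineRot ρ w c (S r) (C r) x 2)]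
  have hcont : Continuous fun r => affineRot ρ w c (S r) (C r) x 3 :=
    (continuous_apply (3 : Fin 4)).comp (continuous_iff_continuousAt.2 fun r =>
      (hasDerivAt_affineRot ρ hw c hS hC x r).continuousAt)
  by_contra! hle
  have h0 : 0 < affineRot ρ w c (S 0) (C 0) x 3 := by
    rw [hS0, hC0, affineRot_zero_zero]; exact hx3 hneg
  obtain ⟨r, -, hr⟩ := isPreconnected_univ.intermediate_value (Set.mem_univ t) (Set.mem_univ 0)
    hcont.continuousOn ⟨hle, h0.le⟩
  exact hne r hr

theorem isFlow_affineRot {ρ : ℝ} {w : E4} {c : ℝ} (hw : w 2 = 0) (hw3 : ρ = 0 → w 3 = 0)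
    (hc : ρ ≠ 0 → c = 0) {S C : ℝ → ℝ} (hS0 : S 0 = 0) (hC0 : C 0 = 0)
    (hS : ∀ t, HasDerivAt S (1 - form ρ w w * C t) t) (hC : ∀ t, HasDerivAt C (S t) t)
    {X : E4 → E4} (hX : Set.EqOn X (rotField ρ w c) (M3 ρ)) :
    IsFlow ρ X fun t => affineRot ρ w c (S t) (C t) where
  zero x _ := by rw [hS0, hC0, affineRot_zero_zero]
  mapsTo t x hx := affineRot_mem_M3 hw hw3 hc hS0 hC0 hS hC hx t
  hasDerivAt t x hx := by
    rw [hX (affineRot_mem_M3 hw hw3 hc hS0 hC0 hS hC hx t)]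
    exact hasDerivAt_affineRot ρ hw c hS hC x t

theorem IsFlow.eq_affineRot {ρ : ℝ} {w : E4} {c : ℝ} (hw : w 2 = 0) {S C : ℝ → ℝ}
    (hS0 : S 0 = 0) (hC0 : C 0 = 0)
    (hS : ∀ t, HasDerivAt S (1 - form ρ w w * C t) t) (hC : ∀ t, HasDerivAt C (S t) t)
    {X : E4 → E4} (hX : Set.EqOn X (rotField ρ w c) (M3 ρ)) {φ : ℝ → E4 → E4}
    (hφ : IsFlow ρ X φ) {x : E4} (hx : x ∈ M3 ρ) (t : ℝ) :
    φ t x = affineRot ρ w c (S t) (C t) x := by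
  refine congrFun (eq_of_hasDerivAt_rotField ρ w c (f := fun r => φ r x) (fun r => ?_)
    (hasDerivAt_affineRot ρ hw c hS hC x) ?_) t
  · rw [← hX (hφ.mapsTo r x hx)]; exact hφ.hasDerivAt r x hx
  · simp only [hφ.zero x hx, hS0, hC0, affineRot_zero_zero]

theorem IsFlow.add {ρ : ℝ} {w : E4} {c : ℝ}
    {X : E4 → E4} (hX : Set.EqOn X (rotField ρ w c) (M3 ρ)) {φ : ℝ → E4 → E4}
    (hφ : IsFlow ρ X φ) {x : E4} (hx : x ∈ M3 ρ) (s t : ℝ) :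
    φ (s + t) x = φ s (φ t x) := by
  have hy := hφ.mapsTo t x hx
  refine congrFun (eq_of_hasDerivAt_rotField ρ w c (f := fun r => φ (r + t) x)
    (g := fun r => φ r (φ t x)) (fun r => ?_) (fun r => ?_) ?_) s
  · rw [← hX (hφ.mapsTo _ x hx)]
    exact (hφ.hasDerivAt (r + t) x hx).comp_add_const r t
  · rw [← hX (hφ.mapsTo _ _ hy)]
    exact hφ.hasDerivAt r _ hy
  · simp only [zero_add, hφ.zero _ hy]

theorem isKillingField_rotField {ρ : ℝ} {w : E4} {c : ℝ} (hw3 : ρ = 0 → w 3 = 0)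
    (hc : ρ ≠ 0 → c = 0) : IsKillingField ρ (rotField ρ w c) := by
  let L : E4 →L[ℝ] E4 := LinearMap.toContinuousLinearMap (gen ρ w)
  have hd : ∀ x v, fderiv ℝ (rotField ρ w c) x v = gen ρ w v := fun x v => by
    have : HasFDerivAt (rotField ρ w c) L x := (L.hasFDerivAt (x := x)).add_const (c • e2)
    rw [this.fderiv]; rfl
  refine ⟨L.contDiff.add contDiff_const, fun x hx => ?_, fun x hx v hv u hu => ?_⟩
  · by_cases hρ : ρ = 0
    · simp [hρ, tangent, rotField, gen_apply, hw3 hρ, e2]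
    · rw [mem_tangent_iff hρ, rotField, hc hρ, zero_smul, add_zero]
      have := form_gen_left ρ w x x
      rw [form_comm] at this
      linarith
  · rw [hd, hd, form_comm ρ v, form_proj_of_mem_tangent hu, form_proj_of_mem_tangent hv,
      form_gen_left, form_comm ρ v]
    ring

/-- A flow of an infinitesimal rotation is a one-parameter group of rotations. -/
theorem IsFlow.isRotationGroup {ρ : ℝ} {w : E4} {c : ℝ} (hw : w 2 = 0) (hw3 : ρ = 0 → w 3 = 0)
    (hc : ρ ≠ 0 → c = 0) (hw0 : w ≠ 0)
    {X : E4 → E4} (hX : Set.EqOn X (rotField ρ w c) (M3 ρ)) {φ : ℝ → E4 → E4}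
    (hφ : IsFlow ρ X φ) (hne : ∃ x ∈ M3 ρ, X x ≠ 0) : IsRotationGroup ρ φ := by
  obtain ⟨S, C, -, -, hS0, hC0, hS, hC⟩ := exists_sine_versine (form ρ w w)
  have heq : ∀ t, ∀ x ∈ M3 ρ, φ t x = affineRot ρ w c (S t) (C t) x :=
    fun t x hx => hφ.eq_affineRot hw hS0 hC0 hS hC hX hx t
  have hSC := sine_sq_add_versine_sq hS0 hC0 hS hC
  refine ⟨hφ.mapsTo, hφ.zero, fun s t x hx => hφ.add hX hx s t, fun x hx =>
    continuous_iff_continuousAt.2 fun t => (hφ.hasDerivAt t x hx).continuousAt, ?_, ?_, ?_⟩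
  · obtain ⟨x, hx, hXx⟩ := hne
    by_contra! hfix
    have h0 := hφ.hasDerivAt 0 x hx
    rw [hφ.zero x hx] at h0
    exact hXx (eq_zero_of_hasDerivAt isOpen_univ (Set.mem_univ 0)
      (fun r _ => hfix r x hx) h0)
  · rintro rfl
    have hw3 := hw3 rfl
    refine ⟨fun t x hx y hy => ?_, ?_⟩
    · rw [heq t x hx, heq t y hy, affineRot_sub, form_rot_rot 0 hw (hSC t)]
    · have hd : form 0 w w = w 0 * w 0 + w 1 * w 1 := by simp [form, hw, hw3]
      have hd0 : form 0 w w ≠ 0 := fun h => hw0 <| by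
        rw [hd] at h
        have h0 : w 0 = 0 := by nlinarith [mul_self_nonneg (w 0), mul_self_nonneg (w 1)]
        have h1 : w 1 = 0 := by nlinarith [mul_self_nonneg (w 0), mul_self_nonneg (w 1)]
        funext j; fin_cases j <;> simp [h0, h1, hw, hw3]
      -- The axis is the zero set of the field in `ℝ³`: the line `⟨x, w⟩ = -c`, `x₂ = 0`, through
      -- `p` with direction `v` orthogonal to `w`.
      let p : E4 := (-c / form 0 w w) • w
      let v : E4 := ![-w 1, w 0, 0, 0]
      have hvw : form 0 v w = 0 := by simp [form, v]; ring
      have hmem : ∀ r : ℝ, p + r • v ∈ M3 0 := fun r => by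
        rw [mem_M3_zero]; simp [p, v, hw3]
      refine ⟨p, by simpa using hmem 0, v, by simp [mem_tangent_zero, v], fun h => hw0 ?_,
        fun t r => ?_⟩
      · have h0 : w 1 = 0 := by simpa [v] using congrFun h 0
        have h1 : w 0 = 0 := by simpa [v] using congrFun h 1
        funext j; fin_cases j <;> simp [h0, h1, hw, hw3]
      · have h2 : (p + r • v) 2 = 0 := by simp [p, v, hw]
        have hq : rotField 0 w c (p + r • v) = 0 := by
          rw [rotField, gen_apply, h2, form_add_left, form_smul_left, form_smul_left, hvw,
            div_mul_cancel₀ _ hd0]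
          module
        rw [heq t _ (hmem r), affineRot_eq 0 hw, hq]
        simp
  · intro hρ
    -- `gen ρ w` vanishes on the kernel of `f`, which is the pointwise fixed plane. Surjectivity
    -- uses the nondegeneracy of the form, not `⟨w, w⟩ ≠ 0`, so that parabolic rotations are
    -- included.
    let f : E4 →ₗ[ℝ] ℝ × ℝ :=
      { toFun := fun x => (form ρ x w, x 2)
        map_add' := fun x y => by rw [form_add_left]; rfl
        map_smul' := fun a x => by rw [form_smul_left]; rfl }
    have hf : Function.Surjective f := by
      obtain ⟨u, hu2, hu⟩ : ∃ u : E4, u 2 = 0 ∧ form ρ u w ≠ 0 := by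
        by_contra! h
        refine hw0 ?_
        have h0 := h (Pi.single 0 1) (by simp)
        have h1 := h (Pi.single 1 1) (by simp)
        have h3 := h (Pi.single 3 1) (by simp)
        simp only [form] at h0 h1 h3
        have h3' : w 3 = 0 := by
          split_ifs at h3 <;> simpa using h3
        funext j; fin_cases j
        · simpa using h0
        · simpa using h1
        · simpa using hw
        · simpa using h3'
      rintro ⟨a, b⟩
      refine ⟨(a / form ρ u w) • u + b • e2, Prod.ext ?_ ?_⟩
      · change form ρ _ w = a
        rw [form_add_left, form_smul_left, form_smul_left, form_e2_left, hw]
        field_simp; ring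
      · change ((a / form ρ u w) • u + b • e2) 2 = b
        simp [hu2, e2]
    refine ⟨LinearMap.ker f, ?_, fun t => ⟨rot ρ w (S t) (C t),
      form_rot_rot ρ hw (hSC t), fun x hx => ?_, fun x hx => ?_⟩⟩
    · have := f.finrank_range_add_finrank_ker
      rw [LinearMap.range_eq_top.2 hf, finrank_top] at this
      simp at this
      omega
    · have hx' : (form ρ x w, x 2) = (0, 0) := hx
      rw [Prod.mk.injEq] at hx'
      have : gen ρ w x = 0 := by rw [gen_apply, hx'.1, hx'.2]; simp
      rw [rot_apply, this]; simp
    · rw [heq t x hx, affineRot, hc hρ]; simp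

/-! ### The rotation field of a critical curve -/

/-- The binormal field of a critical curve is the restriction of an infinitesimal rotation. -/
theorem IsPlanarFrenetCurve.exists_rotField {ρ μ : ℝ} {I : Set ℝ} {γ N B : ℝ → E4} {κ : ℝ → ℝ}
    (h : IsPlanarFrenetCurve ρ I γ N B κ) (hI : IsOpen I) (hIc : IsPreconnected I) (hμ : μ ≠ 0)
    (hcrit : IsCriticalCurve ρ μ I κ) (hκ : ¬ ∃ c, ∀ s ∈ I, κ s = c) :
    ∃ (w : E4) (c ε : ℝ), w ≠ 0 ∧ w 2 = 0 ∧ (ρ = 0 → w 3 = 0) ∧ (ρ ≠ 0 → c = 0) ∧ ε * ε = 1 ∧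
      ∀ s ∈ I, B s = ε • e2 ∧ form ρ (γ s) w + c = ε * (μ * Real.exp (μ * κ s)) ∧
        form ρ (N s) w = -(ε * ((κ s * μ - 1) * Real.exp (μ * κ s))) := by
  obtain ⟨ε, hε, hB⟩ := h.exists_binormal_eq hI hIc
  have hne : I.Nonempty := by
    by_contra hempty
    exact hκ ⟨0, fun s hs => absurd ⟨s, hs⟩ hempty⟩
  obtain ⟨s₀, hs₀⟩ := hne
  let f : ℝ → ℝ := fun r => Real.exp (μ * κ r)
  have hκs := h.contDiffOn_curvature hI
  have hfs : ContDiffOn ℝ ∞ f I := (contDiffOn_const.mul hκs).exp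
  have hfs' : ContDiffOn ℝ ∞ (deriv f) I := ((contDiffOn_infty_iff_deriv_of_isOpen hI).1 hfs).2
  have hd : ∀ {u : ℝ → ℝ}, ContDiffOn ℝ ∞ u I → ∀ s ∈ I, HasDerivAt u (deriv u s) s :=
    fun hu s hs =>
      ((hu.differentiableOn (by simp)).differentiableAt (hI.mem_nhds hs)).hasDerivAt
  have hfd : ∀ s ∈ I, deriv f s = μ * deriv κ s * f s := fun s hs => by
    rw [(((hd hκs s hs).const_mul μ).exp).deriv]; ring
  -- The coefficients come from differentiating `⟨γ, W⟩ + c = μf` for a constant `W`: `⟨T, W⟩ =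
  -- μf'`, and then `κ⟨N, W⟩ = μf'' + ρμf`, which the Euler–Lagrange equation turns into `-κ(κμ -
  -- 1)f`.
  let W : ℝ → E4 := fun s =>
    (ρ * μ * f s) • γ s + (μ * deriv f s) • deriv γ s - ((κ s * μ - 1) * f s) • N s
  have hW : ∀ s ∈ I, HasDerivAt W 0 s := fun s hs => by
    have h1 := hd hfs s hs
    refine (((h1.const_mul (ρ * μ)).smul (h.hasDerivAt_curve hI hs)).add
      (((hd hfs' s hs).const_mul μ).smul (h.hasDerivAt_tangent hI hs)) |>.sub
      (((((hd hκs s hs).mul_const μ).sub_const 1).mul h1).smul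
        (h.hasDerivAt_normal hI hs))).congr_deriv ?_
    have hEL : μ * deriv (deriv f) s + (κ s ^ 2 * μ - κ s + ρ * μ) * f s = 0 := by
      have := hcrit s hs
      change deriv (deriv f) s + (κ s ^ 2 - κ s / μ + ρ) * f s = 0 at this
      have h2 : (κ s ^ 2 * μ - κ s + ρ * μ) = μ * (κ s ^ 2 - κ s / μ + ρ) := by field_simp
      rw [h2]; linear_combination μ * this
    -- In `W'` the `γ` terms cancel identically; these are the `T` and `N` terms.
    have hT : (μ * deriv (deriv f) s + (κ s ^ 2 * μ - κ s + ρ * μ) * f s) • deriv γ s = 0 := by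
      rw [hEL, zero_smul]
    have hN : (deriv f s - μ * deriv κ s * f s) • N s = 0 := by
      rw [hfd s hs, sub_self, zero_smul]
    simp only [Pi.mul_apply]
    linear_combination (norm := module) hT + hN
  have hWc : ∀ s ∈ I, W s = W s₀ := fun s hs =>
    hI.is_const_of_deriv_eq_zero hIc
      (fun r hr => (hW r hr).differentiableAt.differentiableWithinAt)
      (fun r hr => (hW r hr).deriv) hs hs₀
  have hNγ : ∀ s ∈ I, ρ * form ρ (N s) (γ s) = 0 := fun s hs =>
    mul_form_of_mem_tangent (h.normal_tangent s hs).1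
  have hTγ : ∀ s ∈ I, ρ * form ρ (deriv γ s) (γ s) = 0 := fun s hs =>
    mul_form_of_mem_tangent (h.tangent_mem hI hs).1
  have hTW : ∀ s ∈ I, form ρ (deriv γ s) (W s₀) = μ * deriv f s := fun s hs => by
    rw [← hWc s hs]
    simp only [W, form_sub_right, form_add_right, form_smul_right, h.arc_length s hs,
      h.normal_orth s hs]
    linear_combination (μ * f s) * hTγ s hs
  have hNW : ∀ s ∈ I, form ρ (N s) (W s₀) = -((κ s * μ - 1) * f s) := fun s hs => by
    rw [← hWc s hs]
    simp only [W, form_sub_right, form_add_right, form_smul_right, h.normal_unit s hs,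
      form_comm ρ (N s) (deriv γ s), h.normal_orth s hs]
    linear_combination (μ * f s) * hNγ s hs
  have hcd : ∀ s ∈ I, HasDerivAt (fun r => μ * f r - form ρ (γ r) (W s₀)) 0 s := fun s hs => by
    refine (((hd hfs s hs).const_mul μ).sub (hasDerivAt_form ρ (h.hasDerivAt_curve hI hs)
      (hasDerivAt_const s (W s₀)))).congr_deriv ?_
    rw [form_comm ρ (γ s) 0, form_zero_left, hTW s hs]; ring
  have hcc : ∀ s ∈ I, μ * f s - form ρ (γ s) (W s₀) = μ * f s₀ - form ρ (γ s₀) (W s₀) :=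
    fun s hs => hI.is_const_of_deriv_eq_zero hIc
      (fun r hr => (hcd r hr).differentiableAt.differentiableWithinAt)
      (fun r hr => (hcd r hr).deriv) hs hs₀
  set c := μ * f s₀ - form ρ (γ s₀) (W s₀)
  have hε0 : ε ≠ 0 := fun h0 => by simp [h0] at hε
  have hT := h.tangent_mem hI hs₀
  have hNt := h.normal_tangent s₀ hs₀
  have hγ := h.mem s₀ hs₀
  refine ⟨ε • W s₀, ε * c, ε, ?_, ?_, ?_, ?_, hε, fun s hs => ⟨hB s hs, ?_, ?_⟩⟩
  · intro h0
    have hW0 : W s₀ = 0 := (smul_eq_zero.1 h0).resolve_left hε0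
    refine hκ ⟨Real.log (c / μ) / μ, fun s hs => ?_⟩
    have h1 := hcc s hs
    rw [hW0, form_comm, form_zero_left, sub_zero] at h1
    rw [← h1, mul_div_cancel_left₀ _ hμ, Real.log_exp, mul_div_cancel_left₀ _ hμ]
  · simp [W, hγ.2, hT.2, hNt.2]
  · rintro rfl
    simp [W, mem_tangent_zero.1 hT.1, mem_tangent_zero.1 hNt.1]
  · intro hρ
    have : form ρ (γ s₀) (W s₀) = μ * f s₀ := by
      simp only [W, form_sub_right, form_add_right, form_smul_right,
        (mem_tangent_iff hρ).1 hT.1, (mem_tangent_iff hρ).1 hNt.1]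
      linear_combination (μ * f s₀) * mul_form_self hγ.1 hρ
    simp only [c, this, sub_self, mul_zero]
  · rw [form_smul_right]
    linear_combination (-ε) * hcc s hs
  · rw [form_smul_right, hNW s hs]; ring

/-! ### The evolution surface -/

/-- The generating field is invariant under its own flow, so the orbit velocity is the rotated
initial velocity. -/
theorem rotField_affineRot (ρ : ℝ) {w : E4} (hw : w 2 = 0) (c a b : ℝ) (x : E4) :
    rotField ρ w c (affineRot ρ w c a b x) = rot ρ w a b (rotField ρ w c x) := by
  rw [affineRot_eq ρ hw, rot_apply]
  conv_lhs => rw [rotField]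
  simp only [map_add, map_smul]
  rw [rotField, map_add, map_smul]
  abel

theorem hasDerivAt_rot_apply (ρ : ℝ) (w : E4) (a b : ℝ) {u : ℝ → E4} {u' : E4} {s : ℝ}
    (hu : HasDerivAt u u' s) :
    HasDerivAt (fun r => rot ρ w a b (u r)) (rot ρ w a b u') s :=
  (LinearMap.toContinuousLinearMap (rot ρ w a b)).hasFDerivAt.comp_hasDerivAt s hu

theorem hasDerivAt_rot (ρ : ℝ) {w : E4} (hw : w 2 = 0) {S C : ℝ → ℝ}
    (hS : ∀ t, HasDerivAt S (1 - form ρ w w * C t) t) (hC : ∀ t, HasDerivAt C (S t) t)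
    (x : E4) (t : ℝ) :
    HasDerivAt (fun r => rot ρ w (S r) (C r) x) (rot ρ w (S t) (C t) (gen ρ w x)) t := by
  simp only [rot_apply]
  refine ((((hS t).smul_const (gen ρ w x)).const_add x).add
    ((hC t).smul_const (gen ρ w (gen ρ w x)))).congr_deriv ?_
  rw [gen_gen_gen ρ hw]; module

theorem contDiffOn_affineRot (ρ : ℝ) {w : E4} (hw : w 2 = 0) (c : ℝ) {S C : ℝ → ℝ}
    (hS : ContDiff ℝ ∞ S) (hC : ContDiff ℝ ∞ C) {γ : ℝ → E4} {I : Set ℝ}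
    (hγ : ContDiffOn ℝ ∞ γ I) :
    ContDiffOn ℝ ∞ (fun p : ℝ × ℝ => affineRot ρ w c (S p.2) (C p.2) (γ p.1))
      (I ×ˢ Set.univ) := by
  have hL : ContDiff ℝ ∞ (gen ρ w) := (LinearMap.toContinuousLinearMap (gen ρ w)).contDiff
  have h1 : ContDiffOn ℝ ∞ (fun p : ℝ × ℝ => γ p.1) (I ×ˢ Set.univ) :=
    hγ.comp contDiffOn_fst fun p hp => hp.1
  have h2 : ContDiffOn ℝ ∞ (fun p : ℝ × ℝ => rotField ρ w c (γ p.1)) (I ×ˢ Set.univ) :=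
    (hL.add contDiff_const).comp_contDiffOn h1
  simp only [affineRot_eq ρ hw]
  exact (h1.add ((hS.comp contDiff_snd).contDiffOn.smul h2)).add
    ((hC.comp contDiff_snd).contDiffOn.smul (hL.comp_contDiffOn h2))

/-- The partial derivatives of a surface that is swept out by a planar curve under a rotation. -/
theorem IsPlanarFrenetCurve.partial_evolutionSurface {ρ : ℝ} {I : Set ℝ} {γ N B : ℝ → E4}
    {κ : ℝ → ℝ} (h : IsPlanarFrenetCurve ρ I γ N B κ) (hI : IsOpen I) {w : E4} {c : ℝ}
    (hw : w 2 = 0) {S C : ℝ → ℝ}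
    (hS : ∀ t, HasDerivAt S (1 - form ρ w w * C t) t) (hC : ∀ t, HasDerivAt C (S t) t)
    {φ : ℝ → E4 → E4}
    (hφ : ∀ t, ∀ s ∈ I, φ t (γ s) = affineRot ρ w c (S t) (C t) (γ s))
    {g : ℝ → ℝ} (hg : ∀ s ∈ I, form ρ (γ s) w + c = g s) {s : ℝ} (hs : s ∈ I) (t : ℝ) :
    partialS (evolutionSurface φ γ) s t = rot ρ w (S t) (C t) (deriv γ s) ∧
    partialT (evolutionSurface φ γ) s t = rot ρ w (S t) (C t) (g s • e2) ∧
    partialS (partialS (evolutionSurface φ γ)) s t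
      = rot ρ w (S t) (C t) (κ s • N s - ρ • γ s) ∧
    partialS (partialT (evolutionSurface φ γ)) s t
      = rot ρ w (S t) (C t) (form ρ (deriv γ s) w • e2) ∧
    partialT (partialS (evolutionSurface φ γ)) s t
      = rot ρ w (S t) (C t) (form ρ (deriv γ s) w • e2) ∧
    partialT (partialT (evolutionSurface φ γ)) s t = rot ρ w (S t) (C t) (-g s • w) := by
  have hV : ∀ r ∈ I, rotField ρ w c (γ r) = g r • e2 := fun r hr => by
    rw [rotField, gen_apply, h.curve_apply_two hr, ← hg r hr]; module
  have hS1 : ∀ r ∈ I, ∀ t, partialS (evolutionSurface φ γ) r t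
      = rot ρ w (S t) (C t) (deriv γ r) := fun r hr t => by
    have h1 := (hasDerivAt_rot_apply ρ w (S t) (C t) (h.hasDerivAt_curve hI hr)).add_const
      (c • (S t • e2 - C t • w))
    refine (h1.congr_of_eventuallyEq ?_).deriv
    exact Filter.eventuallyEq_of_mem (hI.mem_nhds hr) fun q hq => hφ t q hq
  have hT1 : ∀ r ∈ I, ∀ t, partialT (evolutionSurface φ γ) r t
      = rot ρ w (S t) (C t) (g r • e2) := fun r hr t => by
    have h1 := hasDerivAt_affineRot ρ hw c hS hC (γ r) t
    rw [rotField_affineRot ρ hw, hV r hr] at h1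
    have h2 : (fun q => evolutionSurface φ γ r q)
        = fun q => affineRot ρ w c (S q) (C q) (γ r) := funext fun q => hφ q r hr
    rw [partialT, h2, h1.deriv]
  have hgd : HasDerivAt g (form ρ (deriv γ s) w) s := by
    have h1 := (hasDerivAt_form ρ (h.hasDerivAt_curve hI hs) (hasDerivAt_const s w)).add_const c
    rw [form_comm ρ (γ s) 0, form_zero_left, add_zero] at h1
    exact h1.congr_of_eventuallyEq
      (Filter.eventuallyEq_of_mem (hI.mem_nhds hs) fun q hq => (hg q hq).symm)
  refine ⟨hS1 s hs t, hT1 s hs t, ?_, ?_, ?_, ?_⟩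
  · refine ((hasDerivAt_rot_apply ρ w (S t) (C t)
      (h.hasDerivAt_tangent hI hs)).congr_of_eventuallyEq ?_).deriv
    exact Filter.eventuallyEq_of_mem (hI.mem_nhds hs) fun q hq => hS1 q hq t
  · refine ((hasDerivAt_rot_apply ρ w (S t) (C t)
      (hgd.smul_const e2)).congr_of_eventuallyEq ?_).deriv
    exact Filter.eventuallyEq_of_mem (hI.mem_nhds hs) fun q hq => hT1 q hq t
  · have h1 := hasDerivAt_rot ρ hw hS hC (deriv γ s) t
    rw [gen_apply, (h.tangent_mem hI hs).2, zero_smul, sub_zero] at h1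
    rw [partialT, show (fun r => partialS (evolutionSurface φ γ) s r)
      = fun r => rot ρ w (S r) (C r) (deriv γ s) from funext (hS1 s hs), h1.deriv]
  · have h1 := hasDerivAt_rot ρ hw hS hC (g s • e2) t
    rw [map_smul, gen_e2 ρ hw, smul_neg, ← neg_smul] at h1
    rw [partialT, show (fun r => partialT (evolutionSurface φ γ) s r)
      = fun r => rot ρ w (S r) (C r) (g s • e2) from funext (hT1 s hs), h1.deriv]

theorem linearIndependent_of_form {ρ : ℝ} {u v : E4} (hu : form ρ u u ≠ 0) (hv : form ρ v v ≠ 0)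
    (huv : form ρ u v = 0) : LinearIndependent ℝ ![u, v] := by
  rw [LinearIndependent.pair_iff]
  intro a b hab
  have h1 : form ρ (a • u + b • v) u = 0 := by rw [hab, form_zero_left]
  have h2 : form ρ (a • u + b • v) v = 0 := by rw [hab, form_zero_left]
  rw [form_add_left, form_smul_left, form_smul_left] at h1 h2
  rw [form_comm ρ v u, huv] at h1
  rw [huv] at h2
  constructor
  · simpa [hu] using h1
  · simpa [hv] using h2

/-- The skew curvature in terms of orthogonal principal parameters. -/
theorem skewCurvature_of_diagonal {ρ : ℝ} {F : ℝ → ℝ → E4} {s t : ℝ} {η : E4} {G k₁ k₂ : ℝ}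
    (hG : G ≠ 0) (h1 : firstForm ρ F s t = !![1, 0; 0, G])
    (h2 : secondForm ρ F s t η = !![k₁, 0; 0, G * k₂]) :
    skewCurvature ρ F s t η = |k₁ - k₂| := by
  have hinv : (!![1, 0; 0, G] : Matrix (Fin 2) (Fin 2) ℝ)⁻¹ = !![1, 0; 0, G⁻¹] := by
    refine Matrix.inv_eq_right_inv ?_
    ext i j; fin_cases i <;> fin_cases j <;> simp [hG]
  have hA : shapeOperator ρ F s t η = !![k₁, 0; 0, k₂] := by
    rw [shapeOperator, h1, h2, hinv]
    ext i j; fin_cases i <;> fin_cases j <;> simp [hG]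
  rw [skewCurvature, meanCurvature, gaussCurvature, hA, Matrix.trace_fin_two_of,
    Matrix.det_fin_two_of]
  rw [show ((k₁ + k₂) / 2) ^ 2 - (k₁ * k₂ - 0 * 0 + ρ) + ρ = ((k₁ - k₂) / 2) ^ 2 by ring,
    Real.sqrt_sq_eq_abs, abs_div, abs_two]
  ring

/-- The surface swept out by a planar curve under a rotation is immersed away from the axis. -/
theorem IsPlanarFrenetCurve.isImmersedSurface {ρ : ℝ} {I : Set ℝ} {γ N B : ℝ → E4}
    {κ : ℝ → ℝ} (h : IsPlanarFrenetCurve ρ I γ N B κ) (hI : IsOpen I) {w : E4} {c : ℝ}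
    (hw : w 2 = 0) {X : E4 → E4} (hX : Set.EqOn X (rotField ρ w c) (M3 ρ)) {φ : ℝ → E4 → E4}
    (hφ : IsFlow ρ X φ) (hg : ∀ s ∈ I, form ρ (γ s) w + c ≠ 0) :
    IsImmersedSurface ρ I (evolutionSurface φ γ) := by
  obtain ⟨S, C, hSs, hCs, hS0, hC0, hS, hC⟩ := exists_sine_versine (form ρ w w)
  have hSC := sine_sq_add_versine_sq hS0 hC0 hS hC
  have heq : ∀ t, ∀ s ∈ I, φ t (γ s) = affineRot ρ w c (S t) (C t) (γ s) :=
    fun t s hs => hφ.eq_affineRot hw hS0 hC0 hS hC hX (h.mem s hs).1 t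
  refine ⟨fun s hs t => hφ.mapsTo t _ (h.mem s hs).1, ?_, fun s hs t => ?_⟩
  · exact (contDiffOn_affineRot ρ hw c hSs hCs h.smooth_curve).congr
      fun p hp => heq p.2 p.1 hp.1
  · obtain ⟨h1, h2, -⟩ := h.partial_evolutionSurface hI hw hS hC heq (fun _ _ => rfl) hs t
    rw [h1, h2]
    refine linearIndependent_of_form (ρ := ρ) ?_ ?_ ?_ <;> rw [form_rot_rot ρ hw (hSC t)]
    · rw [h.arc_length s hs]; exact one_ne_zero
    · rw [form_smul_left, form_smul_right, form_e2_left, e2_apply_two, mul_one]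
      exact mul_ne_zero (hg s hs) (hg s hs)
    · rw [form_smul_right, form_e2_right, (h.tangent_mem hI hs).2, mul_zero]

/-- A unit normal of the swept surface is, up to sign, the rotated normal of the curve. -/
theorem IsPlanarFrenetCurve.form_rot_unitNormal {ρ : ℝ} {I : Set ℝ} {γ N B : ℝ → E4} {κ : ℝ → ℝ}
    (h : IsPlanarFrenetCurve ρ I γ N B κ) (hI : IsOpen I) {w : E4} {c a b : ℝ} (hw : w 2 = 0)
    (hw3 : ρ = 0 → w 3 = 0) (hc : ρ ≠ 0 → c = 0) (hab : a ^ 2 + form ρ w w * b ^ 2 = 2 * b)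
    {s : ℝ} (hs : s ∈ I) {η : E4} (hη : η ∈ tangent ρ (affineRot ρ w c a b (γ s)))
    (hηη : form ρ η η = 1) (hηT : form ρ η (rot ρ w a b (deriv γ s)) = 0)
    (hηe : form ρ η (rot ρ w a b e2) = 0) :
    ∃ σ : ℝ, σ * σ = 1 ∧ ∀ u, form ρ (rot ρ w a b u) η = σ * form ρ u (N s) := by
  -- The adjoint of the rotation is its inverse; it moves `η` back to `γ s`, where the frame
  -- expansion leaves only the `N` component.
  set η₀ := rot ρ w (-a) b η with hη₀
  have hadj : ∀ u, form ρ η₀ u = form ρ η (rot ρ w a b u) := fun u => by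
    rw [hη₀, form_rot_left, neg_neg]
  have hγ : ρ * form ρ η₀ (γ s) = 0 := by
    by_cases hρ : ρ = 0
    · rw [hρ, zero_mul]
    · rw [hadj]
      have := mul_form_of_mem_tangent hη
      rwa [affineRot, hc hρ, zero_smul, add_zero] at this
  have hexp := frame_expansion (h.mem s hs) (h.tangent_mem hI hs) (h.normal_tangent s hs)
    (h.arc_length s hs) (h.normal_unit s hs) (h.normal_orth s hs) (v := η₀) (by
      intro hρ
      rw [hη₀, rot_apply_three (hw3 hρ)]
      subst hρ
      exact mem_tangent_zero.1 hη)
  rw [hadj (deriv γ s), hηT, hγ, ← form_e2_right ρ η₀, hadj e2, hηe] at hexp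
  simp only [zero_smul, zero_add, add_zero] at hexp
  set σ := form ρ η₀ (N s)
  refine ⟨σ, ?_, fun u => ?_⟩
  · have h1 : form ρ η₀ η₀ = 1 := by
      rw [hη₀, form_rot_rot ρ hw (by linarith [neg_sq a]), hηη]
    rw [hexp, form_smul_left, form_smul_right, h.normal_unit s hs, mul_one] at h1
    exact h1
  · rw [form_comm, ← hadj, hexp, form_smul_left, form_comm ρ (N s)]

/-- By invariance everything is computed at `t = 0`. With `g = ⟨γ, w⟩ + c` the first form is
`diag(1, g²)` and the second is `±diag(κ, -g⟨w, N⟩)`. The hypothesis on `⟨N, w⟩` makes the last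
entry `g²(κ - m)`, so the principal curvatures differ by `m` up to sign. -/
theorem IsPlanarFrenetCurve.hasConstantSkewCurvature {ρ : ℝ} {I : Set ℝ} {γ N B : ℝ → E4}
    {κ : ℝ → ℝ} (h : IsPlanarFrenetCurve ρ I γ N B κ) (hI : IsOpen I) {w : E4} {c m : ℝ}
    (hw : w 2 = 0) (hw3 : ρ = 0 → w 3 = 0) (hc : ρ ≠ 0 → c = 0)
    {X : E4 → E4} (hX : Set.EqOn X (rotField ρ w c) (M3 ρ)) {φ : ℝ → E4 → E4}
    (hφ : IsFlow ρ X φ) (hg : ∀ s ∈ I, form ρ (γ s) w + c ≠ 0)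
    (hN : ∀ s ∈ I, form ρ (N s) w = -((κ s - m) * (form ρ (γ s) w + c))) :
    HasConstantSkewCurvature ρ I (evolutionSurface φ γ) |m| := by
  obtain ⟨S, C, -, -, hS0, hC0, hS, hC⟩ := exists_sine_versine (form ρ w w)
  have hSC := sine_sq_add_versine_sq hS0 hC0 hS hC
  have heq : ∀ t, ∀ s ∈ I, φ t (γ s) = affineRot ρ w c (S t) (C t) (γ s) :=
    fun t s hs => hφ.eq_affineRot hw hS0 hC0 hS hC hX (h.mem s hs).1 t
  intro s hs t
  obtain ⟨h1, h2, h3, h4, h5, h6⟩ :=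
    h.partial_evolutionSurface hI hw hS hC heq (fun _ _ => rfl) hs t
  set g := form ρ (γ s) w + c with hgdef
  have hg0 : g ≠ 0 := hg s hs
  have hF : evolutionSurface φ γ s t = affineRot ρ w c (S t) (C t) (γ s) := heq t s hs
  have hTan := h.normal_tangent s hs
  have hT2 := (h.tangent_mem hI hs).2
  refine ⟨⟨rot ρ w (S t) (C t) (N s), ?_, ?_, ?_, ?_⟩, fun η hη => ?_⟩
  · rw [hF]
    by_cases hρ : ρ = 0
    · subst hρ
      rw [mem_tangent_zero, rot_apply_three (hw3 rfl)]
      exact mem_tangent_zero.1 hTan.1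
    · rw [mem_tangent_iff hρ, affineRot, hc hρ, zero_smul, add_zero, form_rot_rot ρ hw (hSC t)]
      exact (mem_tangent_iff hρ).1 hTan.1
  · rw [form_rot_rot ρ hw (hSC t), h.normal_unit s hs]
  · rw [h1, form_rot_rot ρ hw (hSC t), form_comm, h.normal_orth s hs]
  · rw [h2, form_rot_rot ρ hw (hSC t), form_smul_right, form_e2_right, hTan.2, mul_zero]
  · obtain ⟨hηt, hηη, hηS, hηT⟩ := hη
    rw [h1] at hηS
    rw [h2, map_smul, form_smul_right] at hηT
    obtain ⟨σ, hσ, hrot⟩ := h.form_rot_unitNormal hI hw hw3 hc (hSC t) hs (hF ▸ hηt) hηη hηS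
      ((mul_eq_zero.1 hηT).resolve_left hg0)
    have hfirst : firstForm ρ (evolutionSurface φ γ) s t = !![1, 0; 0, g * g] := by
      simp only [firstForm, h1, h2, form_rot_rot ρ hw (hSC t), form_smul_left, form_smul_right,
        form_e2_left, form_e2_right, h.arc_length s hs, hT2, Pi.smul_apply, smul_eq_mul, e2_apply_two, mul_zero,
        mul_one]
    have hsecond : secondForm ρ (evolutionSurface φ γ) s t η
        = !![σ * κ s, 0; 0, g * g * (σ * (κ s - m))] := by
      simp only [secondForm, form_proj_of_mem_tangent hηt, h3, h4, h5, h6, hrot, form_sub_left,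
        form_smul_left, form_e2_left, hTan.2, h.normal_unit s hs, mul_zero, mul_one,
        form_comm ρ (γ s) (N s), mul_form_of_mem_tangent hTan.1, sub_zero,
        form_comm ρ w (N s), hN s hs]
      congr 3
      rw [← hgdef]; ring_nf
    rw [skewCurvature_of_diagonal (mul_ne_zero hg0 hg0) hfirst hsecond]
    rw [show σ * κ s - σ * (κ s - m) = σ * m by ring, abs_mul]
    rcases mul_self_eq_one_iff.1 hσ with h' | h' <;> simp [h']

end SkewCurv

/-! ### Assembly of the main theorem -/

open SkewCurv
theorem theorem2 (ρ μ : ℝ) (hμ : μ ≠ 0)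
    (I : Set ℝ) (hIo : IsOpen I) (hIc : I.OrdConnected)
    (γ N B : ℝ → E4) (κ : ℝ → ℝ)
    (hγ : IsPlanarFrenetCurve ρ I γ N B κ)
    (hcrit : IsCriticalCurve ρ μ I κ)
    (hκ : ¬ ∃ c, ∀ s ∈ I, κ s = c) :
    (∃ X, IsKillingExtension ρ μ I γ B κ X) ∧
    (∀ X Y, IsKillingExtension ρ μ I γ B κ X → IsKillingExtension ρ μ I γ B κ Y →
      Set.EqOn X Y (M3 ρ)) ∧
    ∀ X, IsKillingExtension ρ μ I γ B κ X →
      (∃ φ, IsFlow ρ X φ) ∧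
      ∀ φ, IsFlow ρ X φ →
        IsRotationalSurface ρ I (evolutionSurface φ γ) φ ∧
        IsProfileCurve ρ I γ φ ∧
        HasConstantSkewCurvature ρ I (evolutionSurface φ γ) (1 / |μ|) := by
  obtain ⟨s₀, hs₀, hκ₀⟩ : ∃ s ∈ I, κ s ≠ 0 := by
    by_contra! h
    exact hκ ⟨0, h⟩
  obtain ⟨w, c, ε, hw0, hw, hw3, hc, hε, hdata⟩ :=
    hγ.exists_rotField hIo hIc.isPreconnected hμ hcrit hκ
  have hε0 : ε ≠ 0 := fun h0 => by simp [h0] at hε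
  have hg : ∀ s ∈ I, form ρ (γ s) w + c ≠ 0 := fun s hs => by
    rw [(hdata s hs).2.1]
    exact mul_ne_zero hε0 (mul_ne_zero hμ (Real.exp_pos _).ne')
  have hext : IsKillingExtension ρ μ I γ B κ (rotField ρ w c) := by
    refine ⟨isKillingField_rotField hw3 hc, fun s hs => ?_⟩
    obtain ⟨h1, h2, -⟩ := hdata s hs
    rw [rotField, gen_apply, hγ.curve_apply_two hs, h1, smul_smul, mul_comm _ ε, ← h2]
    module
  have huniq : ∀ X Y, IsKillingExtension ρ μ I γ B κ X → IsKillingExtension ρ μ I γ B κ Y →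
      Set.EqOn X Y (M3 ρ) := fun X Y hX hY =>
    eqOn_of_eq_on_curve hγ hIo hs₀ hκ₀ hX.1 hY.1 fun r hr => by rw [hX.2 r hr, hY.2 r hr]
  refine ⟨⟨_, hext⟩, huniq, fun X hX => ?_⟩
  -- By uniqueness an arbitrary extension agrees on `M3 ρ` with the explicit rotation field.
  have hXw := huniq X _ hX hext
  refine ⟨?_, fun φ hφ => ⟨⟨?_, ?_, fun t => ?_⟩, fun s hs => ?_, ?_⟩⟩
  · obtain ⟨S, C, -, -, hS0, hC0, hS, hC⟩ := exists_sine_versine (form ρ w w)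
    exact ⟨_, isFlow_affineRot hw hw3 hc hS0 hC0 hS hC hXw⟩
  · exact hγ.isImmersedSurface hIo hw hXw hφ hg
  · refine hφ.isRotationGroup hw hw3 hc hw0 hXw ⟨γ s₀, (hγ.mem s₀ hs₀).1, fun h0 => ?_⟩
    have h1 := hX.2 s₀ hs₀
    rw [h0, (hdata s₀ hs₀).1, smul_smul] at h1
    have h2 := congrFun h1 2
    simp [e2, hμ, hε0] at h2
  · ext x
    constructor
    · rintro ⟨_, ⟨s, hs, r, rfl⟩, rfl⟩
      exact ⟨s, hs, t + r, (hφ.add hXw (hγ.mem s hs).1 t r).symm⟩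
    · rintro ⟨s, hs, r, rfl⟩
      refine ⟨_, ⟨s, hs, r - t, rfl⟩, ?_⟩
      rw [evolutionSurface, ← hφ.add hXw (hγ.mem s hs).1, add_sub_cancel, evolutionSurface]
  · have hm := (hγ.mem s hs).1
    have h1 := hφ.hasDerivAt 0 _ hm
    rw [hφ.zero _ hm, hX.2 s hs, (hdata s hs).1] at h1
    rw [h1.deriv, form_smul_right, form_smul_right, form_e2_right, (hγ.tangent_mem hIo hs).2]
    ring
  · rw [← abs_one_div]
    -- Here `m = 1 / μ`, since `(κμ - 1) f = (κ - 1/μ) μ f`.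
    refine hγ.hasConstantSkewCurvature hIo hw hw3 hc hXw hφ hg fun s hs => ?_
    obtain ⟨-, h2, h3⟩ := hdata s hs
    rw [h2, h3]
    field_simp
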